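/- Let $E$ be a real Banach lattice. A bounded set $A\subseteq E$ is called disjointly weakly compact if every disjoint sequence (i.e. $|x_m|\wedge|x_n|=0$ for $m\neq n$) contained in the solid hull $\mathrm{Sol}(A)=\{y\in E: |y|\le |x| \text{ for some } x\in A\}$ converges weakly to $0$. For a real Banach space $X$, a bounded linear operator $T:E\to X$ is called DW-compact if $T(A)$ is relatively compact in the norm topology for every disjointly weakly compact set $A\subseteq E$. Recall that $E$ has the Schur property if every sequence in $E$ that converges weakly to $0$ converges to $0$ in norm. Then the following assertions are equivalent: 1. $E$ has the Schur property. 2. Every disjointly weakly compact subset of $E$ is relatively compact; that is, the identity operator $I:E\to E$ is DW-compact. 3. Every bounded linear operator $T:E\to X$ from $E$ to an arbitrary real Banach space $X$ is DW-compact. 4. Every bounded linear operator $T:E\to \ell_\infty$ is DW-compact. -/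

import Mathlib

open Filter Topology
open scoped ENNReal

universe u v

namespace DWCompactness

/-- A sequence converges weakly to zero: it tends to `0` for the weak topology `σ(X, X')`. -/
def IsWeaklyNull {X : Type*} [NormedAddCommGroup X] [NormedSpace ℝ X] (x : ℕ → X) : Prop :=
  Tendsto (fun n => toWeakSpace ℝ X (x n)) atTop (𝓝 0)

/-- The Schur property: every weakly null sequence is norm null. -/
def HasSchurProperty (X : Type*) [NormedAddCommGroup X] [NormedSpace ℝ X] : Prop :=
  ∀ x : ℕ → X, IsWeaklyNull x → Tendsto (fun n => ‖x n‖) atTop (𝓝 0)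

/-- Disjoint sequences of a vector lattice: `|xₘ| ∧ |xₙ| = 0` for `m ≠ n`. -/
def IsDisjointSeq {E : Type*} [AddCommGroup E] [Lattice E] (x : ℕ → E) : Prop :=
  ∀ m n : ℕ, m ≠ n → |x m| ⊓ |x n| = 0

/-- A bounded subset `A` of a normed lattice is disjointly weakly compact if every disjoint
sequence in its solid hull `{y | ∃ x ∈ A, |y| ≤ |x|}` converges weakly to zero. -/
def IsDisjointlyWeaklyCompact {E : Type*} [NormedAddCommGroup E] [NormedSpace ℝ E] [Lattice E]
    (A : Set E) : Prop :=
  Bornology.IsBounded A ∧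
    ∀ x : ℕ → E, (∀ n, x n ∈ LatticeOrderedAddCommGroup.solidClosure A) →
      IsDisjointSeq x → IsWeaklyNull x

/-- Relatively compact for the norm topology: the closure is compact. -/
def IsRelativelyCompact {X : Type*} [TopologicalSpace X] (A : Set X) : Prop :=
  IsCompact (closure A)

/-- A bounded operator is DW-compact if it maps disjointly weakly compact sets onto relatively
compact sets. -/
def IsDWCompact {E X : Type*} [NormedAddCommGroup E] [NormedSpace ℝ E] [Lattice E]
    [NormedAddCommGroup X] [NormedSpace ℝ X] (T : E →L[ℝ] X) : Prop :=
  ∀ A : Set E, IsDisjointlyWeaklyCompact A → IsRelativelyCompact (T '' A)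

end DWCompactness

set_option linter.unusedSectionVars false

/-! From the Schur property to compactness there are two steps. A disjointly weakly compact set lies
within any ε of some order interval [-y, y] (`IsDisjointlyWeaklyCompact.exists_norm_posPart_lt`):
otherwise its solid hull contains a disjoint sequence, weakly null by hypothesis, that is not norm
null. And order intervals are totally bounded (`HasSchurProperty.totallyBounded_Icc`), because every
sequence in [0, x] has a subsequence whose paired differences are weakly null, hence norm null.

To get these differences, smallness of the norm on [0, x], up to an error η, is controlled by a
positive functional φ (`HasSchurProperty.exists_functional`). On the ideal generated by x, φ extends
to a positive functional on bounded functions of the lattice characters, so it is dominated by a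
Hilbertian seminorm (`exists_bilin_of_positive`). A diagonal extraction makes the differences
asymptotically orthogonal for countably many such forms. Averages of k of them then have φ-mass
tending to 0, which is incompatible with a functional staying above ε on infinitely many of them.

Conversely, the range of a weakly null sequence is disjointly weakly compact
(`IsWeaklyNull.isDisjointlyWeaklyCompact_range`, a gliding hump). An operator into ℓ∞ that does not
decrease the norms of the terms then turns compactness of the image into norm convergence to 0. -/

namespace DWCompactness

/-! ### Nonnegative scalars and lattice operations. -/

section Smul

variable {V : Type*} [AddCommGroup V] [Lattice V] [Module ℝ V] [IsOrderedModule ℝ V]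

theorem smul_sup_of_nonneg {t : ℝ} (ht : 0 ≤ t) (a b : V) : t • (a ⊔ b) = t • a ⊔ t • b := by
  rcases ht.eq_or_lt with rfl | h
  · simp
  · exact (OrderIso.smulRight (β := V) h).map_sup a b

theorem abs_smul_of_nonneg {t : ℝ} (ht : 0 ≤ t) (a : V) : |t • a| = t • |a| := by
  rw [abs, abs, smul_sup_of_nonneg ht, smul_neg]

theorem smul_posPart_of_nonneg {t : ℝ} (ht : 0 ≤ t) (a : V) : (t • a)⁺ = t • a⁺ := by
  rw [posPart_def, posPart_def, smul_sup_of_nonneg ht, smul_zero]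

theorem smul_inf_of_nonneg {t : ℝ} (ht : 0 ≤ t) (a b : V) : t • (a ⊓ b) = t • a ⊓ t • b := by
  rcases ht.eq_or_lt with rfl | h
  · simp
  · exact (OrderIso.smulRight (β := V) h).map_inf a b

end Smul

/-! ### Disjointness and truncation in vector lattices. -/

section VectorLattice

variable {V : Type*} [AddCommGroup V] [Lattice V] [IsOrderedAddMonoid V]

theorem inf_add_eq_zero {a b c : V} (ha : 0 ≤ a) (hb : 0 ≤ b) (hc : 0 ≤ c)
    (hab : a ⊓ b = 0) (hac : a ⊓ c = 0) : a ⊓ (b + c) = 0 := by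
  refine le_antisymm ?_ (le_inf ha (add_nonneg hb hc))
  have h : (a ⊓ b) + (a ⊓ c) = 0 := by rw [hab, hac, add_zero]
  rw [← h, inf_add, add_inf, add_inf]
  refine le_inf (le_inf ?_ ?_) (le_inf ?_ ?_)
  · exact inf_le_left.trans (le_add_of_nonneg_right ha)
  · exact inf_le_left.trans (le_add_of_nonneg_right hc)
  · exact inf_le_left.trans (le_add_of_nonneg_left hb)
  · exact inf_le_right

theorem abs_sum_le_sum_abs_lattice {ι : Type*} (s : Finset ι) (z : ι → V) :
    |∑ i ∈ s, z i| ≤ ∑ i ∈ s, |z i| := by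
  classical
  induction s using Finset.induction_on with
  | empty => simp
  | insert a s ha ih =>
    rw [Finset.sum_insert ha, Finset.sum_insert ha]
    exact (abs_add_le _ _).trans (by gcongr)

/-- For disjoint positive elements a sum is a supremum, by a + b = a ⊓ b + a ⊔ b. -/
theorem IsDisjointSeq.sum_abs_le {z : ℕ → V} (hz : IsDisjointSeq z) {w : V} (hw : 0 ≤ w)
    {s : Finset ℕ} (hle : ∀ k ∈ s, |z k| ≤ w) : ∑ k ∈ s, |z k| ≤ w := by
  classical
  have hdis : ∀ (s : Finset ℕ) (a : ℕ), a ∉ s → |z a| ⊓ ∑ k ∈ s, |z k| = 0 := by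
    intro s
    induction s using Finset.induction_on with
    | empty => intro a _; simp [abs_nonneg]
    | insert b s hb ih =>
      intro a ha
      rw [Finset.sum_insert hb]
      simp only [Finset.mem_insert, not_or] at ha
      exact inf_add_eq_zero (abs_nonneg _) (abs_nonneg _)
        (Finset.sum_nonneg fun _ _ => abs_nonneg _) (hz a b ha.1) (ih a ha.2)
  induction s using Finset.induction_on with
  | empty => simpa using hw
  | insert a s ha ih =>
    rw [Finset.sum_insert ha, ← inf_add_sup, hdis s a ha, zero_add]
    exact sup_le (hle a (Finset.mem_insert_self a s))
      (ih fun k hk => hle k (Finset.mem_insert_of_mem hk))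

theorem IsDisjointSeq.comp_injective {z : ℕ → V} (hz : IsDisjointSeq z) {σ : ℕ → ℕ}
    (hσ : Function.Injective σ) : IsDisjointSeq fun k => z (σ k) :=
  fun _ _ hmn => hz _ _ (hσ.ne hmn)

/-- The truncation of `u` to the order interval `[-y, y]`. -/
def truncate (u y : V) : V := (u ⊓ y) ⊔ (-y)

theorem abs_truncate_le {u y : V} (hy : 0 ≤ y) : |truncate u y| ≤ y := by
  refine abs_le'.2 ⟨sup_le inf_le_right ((neg_nonpos.2 hy).trans hy), ?_⟩
  exact neg_le.1 le_sup_right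

theorem abs_truncate_le_abs {u y : V} (hy : 0 ≤ y) : |truncate u y| ≤ |u| := by
  have h0 : -|u| ≤ 0 := neg_nonpos.2 (abs_nonneg u)
  refine abs_le'.2 ⟨sup_le (inf_le_left.trans (le_abs_self u))
    ((neg_nonpos.2 hy).trans (abs_nonneg u)), ?_⟩
  refine neg_le.1 (le_trans (le_inf ?_ (h0.trans hy)) le_sup_left)
  exact neg_le.1 (neg_le_abs u)

theorem abs_sub_truncate_le (u y : V) : |u - truncate u y| ≤ (|u| - y)⁺ := by
  refine abs_le'.2 ⟨?_, ?_⟩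
  · have h1 : u - truncate u y ≤ u - u ⊓ y := sub_le_sub_left le_sup_left u
    refine h1.trans ?_
    rw [sub_le_comm, posPart_def]
    refine le_inf ?_ ?_
    · exact sub_le_self _ le_sup_right
    · rw [sub_le_comm]
      exact le_trans (sub_le_sub_right (le_abs_self u) y) le_sup_left
  · rw [neg_sub, sub_le_iff_le_add, posPart_def]
    refine sup_le (inf_le_left.trans (le_add_of_nonneg_left le_sup_right)) ?_
    rw [← sub_le_iff_le_add]
    refine le_trans ?_ le_sup_left
    rw [sub_eq_add_neg, sub_eq_add_neg, add_comm]
    exact add_le_add_left (neg_le_abs u) _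

end VectorLattice

/-! ### Weakly null sequences. -/

section Weak

variable {X : Type*} [NormedAddCommGroup X] [NormedSpace ℝ X]

theorem isWeaklyNull_iff {x : ℕ → X} :
    IsWeaklyNull x ↔ ∀ f : X →L[ℝ] ℝ, Tendsto (fun n => f (x n)) atTop (𝓝 0) := by
  have h : IsWeaklyNull x ↔ ∀ f : X →L[ℝ] ℝ, Tendsto (fun n => f (x n)) atTop (𝓝 (f 0)) :=
    WeakBilin.tendsto_iff_forall_eval_tendsto (B := (topDualPairing ℝ X).flip) fun a b hab =>
      (SeparatingDual.eq_iff_forall_dual_eq (R := ℝ)).2 fun f => LinearMap.congr_fun hab f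
  simpa only [map_zero] using h

theorem IsWeaklyNull.comp {x : ℕ → X} (hx : IsWeaklyNull x) {σ : ℕ → ℕ}
    (hσ : Tendsto σ atTop atTop) : IsWeaklyNull (fun n => x (σ n)) :=
  isWeaklyNull_iff.2 fun f => (isWeaklyNull_iff.1 hx f).comp hσ

/-- Uniform boundedness applied to the sequence viewed in the bidual. -/
theorem IsWeaklyNull.exists_norm_le {x : ℕ → X} (hx : IsWeaklyNull x) :
    ∃ R, ∀ n, ‖x n‖ ≤ R := by
  rw [isWeaklyNull_iff] at hx
  obtain ⟨R, hR⟩ := banach_steinhaus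
    (g := fun n => NormedSpace.inclusionInDoubleDual ℝ X (x n)) (fun f => by
      obtain ⟨C, hC⟩ := (hx f).norm.bddAbove_range
      exact ⟨C, fun n => hC ⟨n, rfl⟩⟩)
  refine ⟨R, fun n => ?_⟩
  have h := (NormedSpace.inclusionInDoubleDualLi (E := X) ℝ).norm_map (x n)
  rw [← h]
  exact hR n

end Weak

/-! ### Functionals on order bounded sums. -/

theorem norm_le_norm_of_abs_le {E : Type*} [NormedAddCommGroup E] [Lattice E] [HasSolidNorm E] {a b : E} (h : |a| ≤ b) : ‖a‖ ≤ ‖b‖ :=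
  norm_le_norm_of_abs_le_abs (h.trans (le_abs_self b))

section NormedLattice

variable {E : Type*} [NormedAddCommGroup E] [NormedSpace ℝ E] [Lattice E]
  [IsOrderedAddMonoid E] [HasSolidNorm E]

/-- Changing signs of the terms turns the left side into one value of `f`, at a vector of modulus at
most `w`. -/
theorem sum_abs_apply_le (f : E →L[ℝ] ℝ) {d : ℕ → E} {w : E} {s : Finset ℕ}
    (h : ∑ i ∈ s, |d i| ≤ w) : ∑ i ∈ s, |f (d i)| ≤ ‖f‖ * ‖w‖ := by
  have h1 : ∀ i, ∃ e : E, |f (d i)| = f e ∧ |e| = |d i| := by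
    intro i
    rcases abs_choice (f (d i)) with h | h
    · exact ⟨d i, h, rfl⟩
    · exact ⟨-d i, by rw [h, map_neg], abs_neg _⟩
  choose e he1 he2 using h1
  have h2 : ‖∑ i ∈ s, e i‖ ≤ ‖w‖ := by
    refine norm_le_norm_of_abs_le ((abs_sum_le_sum_abs_lattice s e).trans ?_)
    simpa only [he2] using h
  calc ∑ i ∈ s, |f (d i)| = f (∑ i ∈ s, e i) := by simp only [he1, map_sum]
    _ ≤ ‖f (∑ i ∈ s, e i)‖ := le_abs_self _
    _ ≤ ‖f‖ * ‖∑ i ∈ s, e i‖ := f.le_opNorm _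
    _ ≤ ‖f‖ * ‖w‖ := by gcongr

theorem isWeaklyNull_of_sum_abs_le {d : ℕ → E} {w : E}
    (h : ∀ n, ∑ i ∈ Finset.range n, |d i| ≤ w) : IsWeaklyNull d := by
  refine isWeaklyNull_iff.2 fun f => ?_
  have hs : Summable fun i => |f (d i)| :=
    summable_of_sum_range_le (fun _ => abs_nonneg _) fun n => sum_abs_apply_le f (h n)
  exact (tendsto_zero_iff_abs_tendsto_zero _).2 hs.tendsto_atTop_zero

end NormedLattice

/-! ### The gliding hump and supporting functionals. -/

theorem exists_frequently_le_abs {a : ℕ → ℝ} (h : ¬ Tendsto a atTop (𝓝 0)) :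
    ∃ δ > 0, ∃ᶠ k in atTop, δ ≤ |a k| := by
  rw [Metric.tendsto_nhds] at h
  push Not at h
  obtain ⟨δ, hδ, h⟩ := h
  exact ⟨δ, hδ, h.mono fun k hk => by simpa using hk⟩

theorem abs_indicator_le (a : ℕ → ℝ) (S : Set ℕ) (k : ℕ) : |S.indicator a k| ≤ |a k| := by
  by_cases hk : k ∈ S <;> simp [hk]

theorem exists_continuousLinearMap_tsum_indicator {X : Type*} [NormedAddCommGroup X]
    [NormedSpace ℝ X] {g : ℕ → X →ₗ[ℝ] ℝ} {C : ℝ}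
    (hg : ∀ N u, ∑ k ∈ Finset.range N, |g k u| ≤ C * ‖u‖) (S : Set ℕ) :
    ∃ G : X →L[ℝ] ℝ, ∀ u, G u = ∑' k, S.indicator (fun k => g k u) k := by
  have hs : ∀ u, Summable fun k => |g k u| := fun u =>
    summable_of_sum_range_le (fun _ => abs_nonneg _) (hg · u)
  have hsS : ∀ u, Summable (S.indicator fun k => g k u) := fun u => (hs u).of_abs.indicator S
  let G : X →ₗ[ℝ] ℝ :=
    { toFun := fun u => ∑' k, S.indicator (fun k => g k u) k
      map_add' := fun u v => by
        rw [← (hsS u).tsum_add (hsS v)]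
        refine tsum_congr fun k => ?_
        by_cases hk : k ∈ S <;> simp [hk]
      map_smul' := fun c u => by
        simp only [RingHom.id_apply, smul_eq_mul]
        rw [← tsum_mul_left]
        refine tsum_congr fun k => ?_
        by_cases hk : k ∈ S <;> simp [hk] }
  refine ⟨G.mkContinuous C fun u => ?_, fun u => rfl⟩
  have h1 : Summable fun k => ‖S.indicator (fun k => g k u) k‖ := (hsS u).norm
  refine (norm_tsum_le_tsum_norm h1).trans ?_
  refine (h1.tsum_le_tsum (abs_indicator_le _ S) (hs u)).trans ?_
  exact Real.tsum_le_of_sum_range_le (fun _ => abs_nonneg _) (hg · u)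

/-- If `∑ |gₖ u| ≤ C ‖u‖` and `x` is weakly null, then `gₖ (xₖ) → 0` (a gliding hump). -/
theorem IsWeaklyNull.tendsto_apply {X : Type*} [NormedAddCommGroup X] [NormedSpace ℝ X]
    {x : ℕ → X} (hx : IsWeaklyNull x) {g : ℕ → X →ₗ[ℝ] ℝ} {C : ℝ}
    (hg : ∀ N u, ∑ k ∈ Finset.range N, |g k u| ≤ C * ‖u‖) :
    Tendsto (fun k => g k (x k)) atTop (𝓝 0) := by
  classical
  by_contra hcon
  obtain ⟨δ, hδ, hfreq⟩ := exists_frequently_le_abs hcon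
  have hs : ∀ u, Summable fun k => |g k u| := fun u =>
    summable_of_sum_range_le (fun _ => abs_nonneg _) (hg · u)
  have hgk : ∀ k u, |g k u| ≤ C * ‖u‖ := fun k u =>
    (Finset.single_le_sum (f := fun k => |g k u|) (fun _ _ => abs_nonneg _)
      (Finset.self_mem_range_succ k)).trans (hg (k + 1) u)
  choose G hGS using exists_continuousLinearMap_tsum_indicator hg
  let gc : ℕ → X →L[ℝ] ℝ := fun k => (g k).mkContinuous C (hgk k)
  -- Weak nullness makes the earlier functionals small at `x n`; summability at `x m` makes the
  -- functionals from `n` on small there.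
  have hnext : ∀ m, ∃ n, m < n ∧ δ ≤ |g n (x n)| ∧
      ∑ k ∈ Finset.range (m + 1), |g k (x n)| < δ / 4 ∧ ∑' k, |g (k + n) (x m)| < δ / 4 := by
    intro m
    have h1 : Tendsto (fun n => ∑ k ∈ Finset.range (m + 1), |g k (x n)|) atTop (𝓝 0) := by
      have h := tendsto_finsetSum (Finset.range (m + 1)) fun k _ =>
        (isWeaklyNull_iff.1 hx (gc k)).abs
      simpa [gc] using h
    have h2 : Tendsto (fun n => ∑' k, |g (k + n) (x m)|) atTop (𝓝 0) :=
      tendsto_sum_nat_add fun k => |g k (x m)|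
    obtain ⟨n, hn, hn1, hn2, hn3⟩ := (hfreq.and_eventually ((eventually_gt_atTop m).and
      ((h1.eventually_lt_const (by positivity : (0 : ℝ) < δ / 4)).and
        (h2.eventually_lt_const (by positivity : (0 : ℝ) < δ / 4))))).exists
    exact ⟨n, hn1, hn, hn2, hn3⟩
  choose next hlt hbig hhead htail using hnext
  let κ : ℕ → ℕ := fun i => next^[i] 0
  have hκ : ∀ i, κ (i + 1) = next (κ i) := fun i => Function.iterate_succ_apply' next i 0
  have hmono : StrictMono κ := strictMono_nat_of_lt_succ fun i => by rw [hκ]; exact hlt _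
  -- At each hump the head and the tail cost less than δ/4 each, so the single functional `G
  -- (Set.range κ)` contradicts weak nullness.
  have hlow : ∀ i, δ / 2 ≤ |G (Set.range κ) (x (κ (i + 1)))| := by
    intro i
    set n := κ (i + 1) with hn
    set h := (Set.range κ).indicator (fun k => g k (x n)) with hh
    have hsum : Summable h := (hs (x n)).of_abs.indicator _
    have hG : G (Set.range κ) (x n) = ∑ k ∈ Finset.range (κ i + 1), h k +
        g n (x n) + ∑' k, h (k + κ (i + 2)) := by
      rw [hGS, ← hh]
      have hle : κ i + 1 ≤ κ (i + 2) := hmono (by omega)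
      rw [← hsum.sum_add_tsum_nat_add (κ (i + 2)), ← Finset.sum_range_add_sum_Ico _ hle]
      congr 2
      rw [Finset.sum_eq_single_of_mem n]
      · simp [hh, hn]
      · rw [Finset.mem_Ico]
        exact ⟨hmono (by omega), hmono (by omega)⟩
      · intro k hk hkn
        refine Set.indicator_of_notMem ?_ _
        rintro ⟨j, rfl⟩
        rw [Finset.mem_Ico, Nat.succ_le_iff, hmono.lt_iff_lt, hmono.lt_iff_lt] at hk
        exact hkn (by rw [hn]; congr 1; omega)
    have hA : |∑ k ∈ Finset.range (κ i + 1), h k| < δ / 4 := by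
      refine ((Finset.abs_sum_le_sum_abs _ _).trans
        (Finset.sum_le_sum fun k _ => abs_indicator_le _ _ k)).trans_lt ?_
      rw [hn, hκ i]
      exact hhead _
    have hT : |∑' k, h (k + κ (i + 2))| < δ / 4 := by
      have h1 : Summable fun k => ‖h (k + κ (i + 2))‖ := (summable_nat_add_iff _).2 hsum.norm
      have h2 : Summable fun k => |g (k + κ (i + 2)) (x n)| :=
        (summable_nat_add_iff (f := fun k => |g k (x n)|) _).2 (hs (x n))
      refine (norm_tsum_le_tsum_norm h1).trans_lt ?_
      refine (h1.tsum_le_tsum (fun k => abs_indicator_le _ _ _) h2).trans_lt ?_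
      rw [hκ (i + 1)]
      exact htail _
    have hB : δ ≤ |g n (x n)| := by
      rw [hn, hκ i]
      exact hbig _
    rw [hG]
    rw [abs_lt] at hA hT
    rcases le_abs'.1 hB with h' | h'
    · exact le_trans (by linarith) (neg_le_abs _)
    · exact le_trans (by linarith) (le_abs_self _)
  have hlim := ((isWeaklyNull_iff.1 (hx.comp ((tendsto_add_atTop_iff_nat 1).2
    hmono.tendsto_atTop)) (G (Set.range κ))).abs).eventually_lt_const
    (by rw [abs_zero]; positivity : |(0 : ℝ)| < δ / 2)
  obtain ⟨i, hi⟩ := hlim.exists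
  exact absurd (hlow i) (not_le.2 hi)

/-- Hahn–Banach from the line through `x`; for negative multiples domination follows from 0 = N 0 ≤
N (t x) + N (-t x). -/
theorem exists_linearMap_le_sublinear {X : Type*} [AddCommGroup X] [Module ℝ X] (N : X → ℝ)
    (hom : ∀ c : ℝ, 0 < c → ∀ u, N (c • u) = c * N u) (add : ∀ u v, N (u + v) ≤ N u + N v)
    (x : X) : ∃ g : X →ₗ[ℝ] ℝ, g x = N x ∧ ∀ u, g u ≤ N u := by
  have h0 : N 0 = 0 := by have := hom 2 (by norm_num) 0; rw [smul_zero] at this; linarith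
  by_cases hx : x = 0
  · obtain ⟨g, -, hg⟩ := exists_extension_of_le_sublinear (⊥ : X →ₗ.[ℝ] ℝ) N hom add (by
      rintro ⟨u, hu⟩
      obtain rfl := (Submodule.mem_bot ℝ).1 hu
      rw [h0]
      exact (map_zero _).le)
    exact ⟨g, by simp [hx, h0], hg⟩
  · obtain ⟨g, hgx, hg⟩ := exists_extension_of_le_sublinear
      (LinearPMap.mkSpanSingleton (K := ℝ) x (N x) hx) N hom add (by
        rintro ⟨u, hu⟩
        obtain ⟨t, rfl⟩ := Submodule.mem_span_singleton.1 hu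
        rw [LinearPMap.mkSpanSingleton'_apply, RingHom.id_apply, smul_eq_mul]
        rcases lt_trichotomy t 0 with ht | rfl | ht
        · have h1 := add (t • x) ((-t) • x)
          rw [← add_smul, add_neg_cancel, zero_smul, h0, hom (-t) (by linarith)] at h1
          change _ ≤ N (t • x)
          linarith
        · simp [h0]
        · exact (hom t ht x).ge)
    refine ⟨g, ?_, hg⟩
    rw [← LinearPMap.mkSpanSingleton_apply ℝ ℝ hx (N x)]
    exact hgx ⟨x, _⟩

/-! ### Variation along disjoint ideals, and ranges of weakly null sequences. -/

section

variable {E : Type*} [NormedAddCommGroup E] [NormedSpace ℝ E] [Lattice E]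
  [IsOrderedAddMonoid E] [IsOrderedModule ℝ E] [HasSolidNorm E]

theorem inf_smul_eq_zero {V : Type*} [AddCommGroup V] [Lattice V] [IsOrderedAddMonoid V]
    [Module ℝ V] [IsOrderedModule ℝ V] {a b : V} (ha : 0 ≤ a) (hb : 0 ≤ b) (hab : a ⊓ b = 0)
    {s t : ℝ} (hs : 0 ≤ s) (ht : 0 ≤ t) : s • a ⊓ t • b = 0 := by
  refine le_antisymm ?_ (le_inf (smul_nonneg hs ha) (smul_nonneg ht hb))
  have hst : 0 ≤ s + t := add_nonneg hs ht
  have h : (s + t) • a ⊓ (s + t) • b = 0 := by rw [← smul_inf_of_nonneg hst, hab, smul_zero]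
  rw [← h]
  exact inf_le_inf (smul_le_smul_of_nonneg_right (le_add_of_nonneg_right ht) ha)
    (smul_le_smul_of_nonneg_right (le_add_of_nonneg_left hs) hb)

/-- The elements of the order interval `[-|u|, |u|]` that lie in the ideal generated by `y`. -/
def localInterval (y u : E) : Set E := {z | |z| ≤ |u| ∧ ∃ t : ℝ, 0 ≤ t ∧ |z| ≤ t • |y|}

/-- The variation of `f` at `u` along the ideal generated by `y`. -/
noncomputable def localVariation (f : E →L[ℝ] ℝ) (y u : E) : ℝ := sSup (f '' localInterval y u)

theorem zero_mem_localInterval (y u : E) : 0 ∈ localInterval y u :=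
  ⟨by simp [abs_nonneg], 0, le_rfl, by simp⟩

theorem bddAbove_image_localInterval (f : E →L[ℝ] ℝ) (y u : E) :
    BddAbove (f '' localInterval y u) := by
  refine ⟨‖f‖ * ‖u‖, ?_⟩
  rintro _ ⟨z, hz, rfl⟩
  refine (le_abs_self _).trans ((f.le_opNorm z).trans ?_)
  gcongr
  exact norm_le_norm_of_abs_le_abs hz.1

theorem apply_le_localVariation (f : E →L[ℝ] ℝ) {y u z : E} (hz : z ∈ localInterval y u) :
    f z ≤ localVariation f y u :=
  le_csSup (bddAbove_image_localInterval f y u) ⟨z, hz, rfl⟩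

theorem localVariation_le {f : E →L[ℝ] ℝ} {y u : E} {c : ℝ}
    (h : ∀ z ∈ localInterval y u, f z ≤ c) : localVariation f y u ≤ c :=
  csSup_le ⟨_, 0, zero_mem_localInterval y u, rfl⟩ (by rintro _ ⟨z, hz, rfl⟩; exact h z hz)

theorem localVariation_neg (f : E →L[ℝ] ℝ) (y u : E) :
    localVariation f y (-u) = localVariation f y u := by
  simp only [localVariation, localInterval, abs_neg]

/-- Riesz decomposition: truncating `z` at `|u|` leaves a remainder dominated by `|v|`, and both
pieces stay in the ideal of `y`. -/
theorem localVariation_add_le (f : E →L[ℝ] ℝ) (y u v : E) :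
    localVariation f y (u + v) ≤ localVariation f y u + localVariation f y v := by
  refine localVariation_le fun z hz => ?_
  obtain ⟨hz, t, ht, hzt⟩ := hz
  have h2 := abs_sub_truncate_le z |u|
  rw [← sub_add_cancel z (truncate z |u|), map_add, add_comm]
  refine add_le_add (apply_le_localVariation f ⟨abs_truncate_le (abs_nonneg u), t, ht,
    (abs_truncate_le_abs (abs_nonneg u)).trans hzt⟩) (apply_le_localVariation f ⟨h2.trans ?_, t, ht,
      h2.trans (le_trans ?_ hzt)⟩)
  · rw [posPart_def]
    refine sup_le ?_ (abs_nonneg v)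
    rw [sub_le_iff_le_add']
    exact hz.trans (abs_add_le u v)
  · rw [posPart_def]
    exact sup_le (sub_le_self _ (abs_nonneg u)) (abs_nonneg z)

theorem localVariation_smul (f : E →L[ℝ] ℝ) (y : E) (c : ℝ) (hc : 0 < c) (u : E) :
    localVariation f y (c • u) = c * localVariation f y u := by
  have key : ∀ (c : ℝ), 0 < c → ∀ u, localVariation f y (c • u) ≤ c * localVariation f y u := by
    intro c hc u
    refine localVariation_le fun z hz => ?_
    obtain ⟨hz, t, ht, hzt⟩ := hz
    have hci : 0 ≤ c⁻¹ := inv_nonneg.2 hc.le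
    have hmem : c⁻¹ • z ∈ localInterval y u := by
      refine ⟨?_, c⁻¹ * t, mul_nonneg hci ht, ?_⟩
      · rw [abs_smul_of_nonneg hci]
        rw [abs_smul_of_nonneg hc.le] at hz
        have h := smul_le_smul_of_nonneg_left hz hci
        rwa [inv_smul_smul₀ hc.ne'] at h
      · rw [abs_smul_of_nonneg hci, mul_smul]
        exact smul_le_smul_of_nonneg_left hzt hci
    have h := apply_le_localVariation f hmem
    rw [map_smul, smul_eq_mul, inv_mul_le_iff₀ hc] at h
    exact h
  refine le_antisymm (key c hc u) ?_
  have h := key c⁻¹ (inv_pos.2 hc) (c • u)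
  rw [inv_smul_smul₀ hc.ne', le_inv_mul_iff₀ hc] at h
  exact h

/-- Near-maximizers taken in disjoint ideals are themselves disjoint and dominated by `|u|`, so
their moduli sum to at most `|u|`. -/
theorem sum_localVariation_le (f : E →L[ℝ] ℝ) {y : ℕ → E} (hy : IsDisjointSeq y) (u : E) (N : ℕ) :
    ∑ k ∈ Finset.range N, localVariation f (y k) u ≤ ‖f‖ * ‖u‖ := by
  refine le_of_forall_pos_le_add fun ε hε => ?_
  have hN : (0 : ℝ) < N + 1 := by positivity
  have h1 : ∀ k, ∃ z ∈ localInterval (y k) u,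
      localVariation f (y k) u - ε / (N + 1) < f z := by
    intro k
    obtain ⟨_, ⟨z, hz, rfl⟩, h⟩ := exists_lt_of_lt_csSup
      (⟨_, 0, zero_mem_localInterval (y k) u, rfl⟩ : (f '' localInterval (y k) u).Nonempty)
      (sub_lt_self (localVariation f (y k) u) (div_pos hε hN))
    exact ⟨z, hz, h⟩
  choose z hz hfz using h1
  have hdis : IsDisjointSeq z := by
    intro m n hmn
    obtain ⟨-, s, hs, hms⟩ := hz m
    obtain ⟨-, t, ht, hnt⟩ := hz n
    refine le_antisymm ((inf_le_inf hms hnt).trans_eq ?_)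
      (le_inf (abs_nonneg _) (abs_nonneg _))
    exact inf_smul_eq_zero (abs_nonneg _) (abs_nonneg _) (hy m n hmn) hs ht
  have h2 := sum_abs_apply_le f (hdis.sum_abs_le (abs_nonneg u)
    (s := Finset.range N) fun k _ => (hz k).1)
  rw [norm_abs_eq_norm] at h2
  calc ∑ k ∈ Finset.range N, localVariation f (y k) u
      ≤ ∑ k ∈ Finset.range N, (|f (z k)| + ε / (N + 1)) :=
        Finset.sum_le_sum fun k _ => by linarith [hfz k, le_abs_self (f (z k))]
    _ = ∑ k ∈ Finset.range N, |f (z k)| + N * (ε / (N + 1)) := by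
        rw [Finset.sum_add_distrib]; simp
    _ ≤ ‖f‖ * ‖u‖ + ε := by
        refine add_le_add h2 ?_
        rw [mul_div_assoc', div_le_iff₀ hN]
        nlinarith

/-- The range of a weakly null sequence is disjointly weakly compact. -/
theorem IsWeaklyNull.isDisjointlyWeaklyCompact_range {x : ℕ → E} (hx : IsWeaklyNull x) :
    IsDisjointlyWeaklyCompact (Set.range x) := by
  constructor
  · obtain ⟨R, hR⟩ := hx.exists_norm_le
    refine isBounded_iff_forall_norm_le.2 ⟨R, ?_⟩
    rintro _ ⟨n, rfl⟩
    exact hR n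
  intro y hyx hy
  have hn : ∀ k, ∃ n, |y k| ≤ |x n| := by
    intro k
    obtain ⟨_, ⟨n, rfl⟩, h⟩ := hyx k
    exact ⟨n, h⟩
  choose n hn using hn
  refine isWeaklyNull_iff.2 fun f => ?_
  by_contra hcon
  obtain ⟨δ, hδ, hfreq⟩ := exists_frequently_le_abs hcon
  obtain ⟨σ, hσ, hbig⟩ := extraction_of_frequently_atTop hfreq
  have hyσ := hy.comp_injective hσ.injective
  -- One `x m` dominates only finitely many of these disjoint terms: each contributes at least δ to
  -- a sum bounded by `‖f‖ * ‖x m‖`.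
  have hlim : Tendsto (fun j => n (σ j)) atTop atTop := by
    rw [← Nat.cofinite_eq_atTop]
    refine Tendsto.cofinite_of_finite_preimage_singleton fun m => ?_
    by_contra hinf
    obtain ⟨N, hN⟩ := exists_nat_gt (‖f‖ * ‖x m‖ / δ)
    obtain ⟨F, hF, hcard⟩ := Set.Infinite.exists_subset_card_eq hinf N
    have h1 := sum_abs_apply_le f (hyσ.sum_abs_le (abs_nonneg (x m)) (s := F) fun k hk => by
      have h2 : n (σ k) = m := hF hk
      rw [← h2]
      exact hn _)
    rw [norm_abs_eq_norm] at h1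
    have h3 : (N : ℝ) * δ ≤ ∑ i ∈ F, |f (y (σ i))| := by
      rw [← hcard, ← nsmul_eq_mul]
      exact Finset.card_nsmul_le_sum _ _ _ fun i _ => hbig i
    rw [div_lt_iff₀ hδ] at hN
    linarith
  -- Functionals supporting the variation at the dominating terms. The gliding hump sends these
  -- values to 0, yet each is at least `|f (y (σ k))|`.
  have hg : ∀ k, ∃ g : E →ₗ[ℝ] ℝ,
      g (x (n (σ k))) = localVariation f (y (σ k)) (x (n (σ k))) ∧
        ∀ u, g u ≤ localVariation f (y (σ k)) u := fun k =>
    exists_linearMap_le_sublinear _ (localVariation_smul f _) (localVariation_add_le f _) _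
  choose g hgx hg using hg
  have habs : ∀ k u, |g k u| ≤ localVariation f (y (σ k)) u := by
    intro k u
    refine abs_le'.2 ⟨hg k u, ?_⟩
    rw [← map_neg, ← localVariation_neg]
    exact hg k (-u)
  have h0 := (hx.comp hlim).tendsto_apply (g := g) (C := ‖f‖) fun N u =>
    (Finset.sum_le_sum fun k _ => habs k u).trans (sum_localVariation_le f hyσ u N)
  obtain ⟨k, hk⟩ := (h0.eventually_lt_const hδ).exists
  refine absurd hk (not_lt.2 ((hbig k).trans ?_))
  rw [hgx]
  have hmem : ∀ z : E, |z| = |y (σ k)| → z ∈ localInterval (y (σ k)) (x (n (σ k))) := fun z hz =>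
    ⟨hz.trans_le (hn _), 1, zero_le_one, by rw [one_smul, hz]⟩
  refine abs_le'.2 ⟨apply_le_localVariation f (hmem _ rfl), ?_⟩
  rw [← map_neg]
  exact apply_le_localVariation f (hmem _ (abs_neg _))

end

/-! ### From operators into ℓ∞ to the Schur property. -/

/-- The coordinates are norming functionals of the `x n`; their continuity lets weak limits identify
limits in ℓ∞. -/
theorem exists_norming_lp {X : Type*} [NormedAddCommGroup X] [NormedSpace ℝ X] (x : ℕ → X) :
    ∃ T : X →L[ℝ] lp (fun _ : ℕ => ℝ) ∞, (∀ n, ‖x n‖ ≤ ‖T (x n)‖) ∧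
      ∀ n, ∃ f : X →L[ℝ] ℝ, ∀ u, T u n = f u := by
  choose f hf1 hfx using fun n => exists_dual_vector'' ℝ (x n)
  have hle : ∀ u n, ‖f n u‖ ≤ ‖u‖ := fun u n => by
    simpa using (f n).le_of_opNorm_le (hf1 n) u
  let T : X →ₗ[ℝ] lp (fun _ : ℕ => ℝ) ∞ :=
    { toFun := fun u => ⟨fun n => f n u, memℓp_infty ⟨‖u‖, by rintro _ ⟨n, rfl⟩; exact hle u n⟩⟩
      map_add' := fun u v => by ext n; exact map_add (f n) u v
      map_smul' := fun c u => by ext n; exact map_smul (f n) c u }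
  refine ⟨T.mkContinuous 1 fun u => ?_, fun n => ?_, fun n => ⟨f n, fun u => rfl⟩⟩
  · rw [one_mul]
    exact lp.norm_le_of_forall_le (norm_nonneg _) (hle u)
  · have h := lp.norm_apply_le_norm ENNReal.top_ne_zero (T (x n)) n
    have h2 : T (x n) n = ‖x n‖ := hfx n
    rw [h2, norm_norm] at h
    exact h

variable {E : Type*} [NormedAddCommGroup E] [NormedSpace ℝ E] [Lattice E]

theorem IsDWCompact.of_comp {X Y : Type*} [NormedAddCommGroup X] [NormedSpace ℝ X]
    [NormedAddCommGroup Y] [NormedSpace ℝ Y] (T : E →L[ℝ] X) (S : X →L[ℝ] Y)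
    (h : IsDWCompact T) : IsDWCompact (S.comp T) := by
  intro A hA
  have h1 : IsCompact (S '' closure (T '' A)) := (h A hA).image S.continuous
  refine h1.of_isClosed_subset isClosed_closure (closure_minimal ?_ h1.isClosed)
  rintro _ ⟨a, ha, rfl⟩
  exact ⟨T a, subset_closure ⟨a, ha, rfl⟩, rfl⟩

variable [IsOrderedAddMonoid E] [IsOrderedModule ℝ E] [HasSolidNorm E]

theorem hasSchurProperty_of_isDWCompact_lp
    (h : ∀ T : E →L[ℝ] lp (fun _ : ℕ => ℝ) ∞, IsDWCompact T) : HasSchurProperty E := by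
  intro x hx
  refine tendsto_of_subseq_tendsto fun σ hσ => ?_
  obtain ⟨T, hT, hTf⟩ := exists_norming_lp x
  have hcomp : IsCompact (closure (T '' Set.range x)) := h T _ hx.isDisjointlyWeaklyCompact_range
  obtain ⟨z, -, τ, hτ, hz⟩ := hcomp.tendsto_subseq (x := fun n => T (x (σ n)))
    fun n => subset_closure ⟨_, ⟨_, rfl⟩, rfl⟩
  have hz0 : z = 0 := by
    ext m
    obtain ⟨f, hf⟩ := hTf m
    have h1 : Tendsto (fun n => T (x (σ (τ n))) m) atTop (𝓝 (z m)) :=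
      ((lp.evalCLM ℝ (fun _ : ℕ => ℝ) ∞ m).continuous.tendsto z).comp hz
    simp only [hf] at h1
    exact tendsto_nhds_unique h1
      (isWeaklyNull_iff.1 (hx.comp (hσ.comp hτ.tendsto_atTop)) f)
  refine ⟨τ, squeeze_zero (fun _ => norm_nonneg _) (fun n => hT _) ?_⟩
  rw [hz0] at hz
  simpa using hz.norm

/-! ### Almost order boundedness. -/

variable [CompleteSpace E]

/-- In a Banach lattice with the Schur property, disjointly weakly compact sets are almost
order bounded. -/
theorem IsDisjointlyWeaklyCompact.exists_norm_posPart_lt (hS : HasSchurProperty E) {A : Set E}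
    (hA : IsDisjointlyWeaklyCompact A) {ε : ℝ} (hε : 0 < ε) :
    ∃ y : E, 0 ≤ y ∧ ∀ a ∈ A, ‖(|a| - y)⁺‖ < ε := by
  by_contra! hcon
  obtain ⟨R, hR⟩ := hA.1.exists_norm_le
  choose! next hmem hnext using hcon
  -- `S n` is the sum of the first `n` chosen moduli
  let S : ℕ → E := fun n => Nat.rec 0 (fun n s => s + |next ((4 : ℝ) ^ n • s)|) n
  let a : ℕ → E := fun n => next ((4 : ℝ) ^ n • S n)
  have hSs : ∀ n, S (n + 1) = S n + |a n| := fun n => rfl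
  have hS0 : ∀ n, 0 ≤ S n := by
    intro n
    induction n with
    | zero => exact le_rfl
    | succ n ih => rw [hSs]; exact add_nonneg ih (abs_nonneg _)
  have hpos : ∀ n, 0 ≤ (4 : ℝ) ^ n • S n := fun n => smul_nonneg (by positivity) (hS0 n)
  have ha : ∀ n, a n ∈ A := fun n => hmem _ (hpos n)
  have han : ∀ n, ε ≤ ‖(|a n| - (4 : ℝ) ^ n • S n)⁺‖ := fun n => hnext _ (hpos n)
  have hSmono : Monotone S := monotone_nat_of_le_succ fun n => by
    rw [hSs]; exact le_add_of_nonneg_right (abs_nonneg _)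
  have hle : ∀ m n, m < n → |a m| ≤ S n := fun m n hmn => by
    refine le_trans ?_ (hSmono (Nat.succ_le_of_lt hmn))
    rw [Nat.succ_eq_add_one, hSs]
    exact le_add_of_nonneg_left (hS0 m)
  have hsum : Summable fun i => ((1 : ℝ) / 2) ^ i • |a i| := by
    refine Summable.of_norm_bounded (g := fun i => ((1 : ℝ) / 2) ^ i * R)
      (summable_geometric_two.mul_right R) fun i => ?_
    rw [norm_smul, norm_abs_eq_norm, Real.norm_of_nonneg (by positivity)]
    exact mul_le_mul_of_nonneg_left (hR _ (ha i)) (by positivity)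
  have hterm : ∀ i, 0 ≤ ((1 : ℝ) / 2) ^ i • |a i| := fun i =>
    smul_nonneg (by positivity) (abs_nonneg _)
  set x : E := ∑' i, ((1 : ℝ) / 2) ^ i • |a i| with hx
  have hxle : ∀ i, ((1 : ℝ) / 2) ^ i • |a i| ≤ x := fun i => hsum.le_tsum i fun j _ => hterm j
  have hx0 : 0 ≤ x := tsum_nonneg hterm
  -- Subtracting 4ⁿ S n makes the term disjoint from earlier ones, and 2⁻ⁿ x from later ones; the
  -- second correction vanishes in norm.
  let y : ℕ → E := fun n => (|a n| - (4 : ℝ) ^ n • S n - ((1 : ℝ) / 2) ^ n • x)⁺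
  have hy0 : ∀ n, 0 ≤ y n := fun n => posPart_nonneg _
  have hcx : ∀ n, 0 ≤ ((1 : ℝ) / 2) ^ n • x := fun n => smul_nonneg (by positivity) hx0
  have hya : ∀ n, y n ≤ |a n| := fun n => by
    refine sup_le ?_ (abs_nonneg _)
    exact (sub_le_self _ (hcx n)).trans (sub_le_self _ (hpos n))
  have hlt : ∀ m n, m < n → y m ⊓ y n = 0 := by
    intro m n hmn
    -- Up to positive factors, `y m` lies below c⁺ and `y n` below c⁻, which are disjoint.
    set c : E := |a m| - ((1 : ℝ) / 4) ^ n • |a n| with hc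
    have h4 : ((1 : ℝ) / 4) ^ n * 4 ^ n = 1 := by rw [← mul_pow]; norm_num
    have hm : y m ≤ (4 : ℝ) ^ n • c⁺ := by
      have h1 : y m ≤ c⁺ := by
        refine posPart_mono ((sub_le_sub_right (sub_le_self _ (hpos m)) _).trans
          (sub_le_sub_left ?_ _))
        refine le_trans ?_ (smul_le_smul_of_nonneg_left (hxle n) (by positivity))
        rw [smul_smul, ← pow_add]
        refine smul_le_smul_of_nonneg_right ?_ (abs_nonneg _)
        have : ((1 : ℝ) / 4) ^ n = (1 / 2) ^ (n + n) := by rw [← two_mul, pow_mul]; norm_num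
        rw [this]
        exact pow_le_pow_of_le_one (by norm_num) (by norm_num) (by omega)
      refine h1.trans ?_
      have h2 : (1 : ℝ) ≤ 4 ^ n := one_le_pow₀ (by norm_num)
      simpa using smul_le_smul_of_nonneg_right h2 (posPart_nonneg c)
    have hn : y n ≤ (4 : ℝ) ^ n • c⁻ := by
      have h1 : c⁻ = (-c)⁺ := by simp
      rw [h1, ← smul_posPart_of_nonneg (by positivity)]
      refine posPart_mono ((sub_le_self _ (hcx n)).trans ?_)
      rw [hc, neg_sub, smul_sub, smul_smul, mul_comm, h4, one_smul]
      exact sub_le_sub_left (smul_le_smul_of_nonneg_left (hle m n hmn) (by positivity)) _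
    refine le_antisymm ((inf_le_inf hm hn).trans_eq ?_) (le_inf (hy0 m) (hy0 n))
    exact inf_smul_eq_zero (posPart_nonneg c) (negPart_nonneg c) (posPart_inf_negPart_eq_zero c)
      (by positivity) (by positivity)
  have hdis : IsDisjointSeq y := by
    intro m n hmn
    rw [abs_of_nonneg (hy0 m), abs_of_nonneg (hy0 n)]
    rcases lt_or_gt_of_ne hmn with h | h
    · exact hlt m n h
    · rw [inf_comm]; exact hlt n m h
  have hnull := hS y (hA.2 y (fun n => ⟨a n, ha n, by
    rw [abs_of_nonneg (hy0 n)]; exact hya n⟩) hdis)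
  have hgeo : Tendsto (fun n => ((1 : ℝ) / 2) ^ n * ‖x‖) atTop (𝓝 0) := by
    simpa using (tendsto_pow_atTop_nhds_zero_of_lt_one (by norm_num : (0 : ℝ) ≤ 1 / 2)
      (by norm_num)).mul_const ‖x‖
  have hlim := hnull.add hgeo
  rw [add_zero] at hlim
  obtain ⟨n, hn⟩ := (hlim.eventually_lt_const hε).exists
  refine absurd hn (not_lt.2 ((han n).trans ?_))
  have h1 : (|a n| - (4 : ℝ) ^ n • S n)⁺ ≤ y n + ((1 : ℝ) / 2) ^ n • x := by
    refine sup_le ?_ (add_nonneg (hy0 n) (hcx n))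
    rw [← sub_le_iff_le_add]
    exact le_posPart _
  have h2 := norm_le_norm_of_abs_le (by rwa [abs_of_nonneg (posPart_nonneg _)] :
    |(|a n| - (4 : ℝ) ^ n • S n)⁺| ≤ y n + ((1 : ℝ) / 2) ^ n • x)
  refine h2.trans ((norm_add_le _ _).trans_eq ?_)
  rw [norm_smul, Real.norm_of_nonneg (by positivity)]

/-! ### Monotone sequences and controlling functionals under the Schur property. -/

section

variable {E : Type*} [NormedAddCommGroup E] [NormedSpace ℝ E] [Lattice E]
  [IsOrderedAddMonoid E] [IsOrderedModule ℝ E] [HasSolidNorm E]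

/-- Otherwise increments of norm at least ε have order bounded partial sums, so they are weakly null
and hence norm null. -/
theorem HasSchurProperty.cauchySeq_of_monotone (hS : HasSchurProperty E) {s : ℕ → E}
    (hs : Monotone s) {x : E} (h0 : ∀ n, 0 ≤ s n) (hx : ∀ n, s n ≤ x) : CauchySeq s := by
  rw [Metric.cauchySeq_iff']
  by_contra! hcon
  obtain ⟨ε, hε, hcon⟩ := hcon
  choose next hge hbig using hcon
  let κ : ℕ → ℕ := fun i => next^[i] 0
  have hκ : ∀ i, κ (i + 1) = next (κ i) := fun i => Function.iterate_succ_apply' next i 0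
  have hpos : ∀ i, 0 ≤ s (κ (i + 1)) - s (κ i) := fun i =>
    sub_nonneg.2 (hs (by rw [hκ]; exact hge _))
  have hnull : IsWeaklyNull fun i => s (κ (i + 1)) - s (κ i) := by
    refine isWeaklyNull_of_sum_abs_le (w := x) fun n => ?_
    simp only [abs_of_nonneg (hpos _)]
    rw [Finset.sum_range_sub fun i => s (κ i)]
    exact (sub_le_self _ (h0 _)).trans (hx _)
  obtain ⟨i, hi⟩ := ((hS _ hnull).eventually_lt_const hε).exists
  refine absurd hi (not_lt.2 ?_)
  rw [← dist_eq_norm, hκ]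
  exact hbig _

theorem HasSchurProperty.cauchySeq_of_antitone (hS : HasSchurProperty E) {s : ℕ → E}
    (hs : Antitone s) {x : E} (h0 : ∀ n, 0 ≤ s n) (hx : ∀ n, s n ≤ x) : CauchySeq s := by
  have h := hS.cauchySeq_of_monotone (s := fun n => x - s n) (x := x)
    (fun m n hmn => sub_le_sub_left (hs hmn) x) (fun n => sub_nonneg.2 (hx n))
    (fun n => sub_le_self _ (h0 n))
  simpa [Function.comp_def] using (uniformContinuous_const (b := x).sub uniformContinuous_id).comp_cauchySeq h

/-- Domination by the sublinear map u ↦ ‖u⁺‖ forces positivity, since this map vanishes on negative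
elements. -/
theorem exists_positive_norming (v : E) (hv : 0 ≤ v) : ∃ φ : E →L[ℝ] ℝ,
    (∀ u, 0 ≤ u → 0 ≤ φ u) ∧ (∀ u, φ u ≤ ‖u‖) ∧ φ v = ‖v‖ := by
  have hle : ∀ u : E, ‖u⁺‖ ≤ ‖u‖ := fun u => by
    refine norm_le_norm_of_abs_le_abs ?_
    rw [abs_of_nonneg (posPart_nonneg u)]
    exact sup_le (le_abs_self u) (abs_nonneg u)
  obtain ⟨g, hgv, hg⟩ := exists_linearMap_le_sublinear (fun u : E => ‖u⁺‖) (fun c hc u => by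
    rw [smul_posPart_of_nonneg hc.le, norm_smul, Real.norm_of_nonneg hc.le]) (fun u v => by
    refine le_trans (norm_le_norm_of_abs_le ?_) (norm_add_le _ _)
    rw [abs_of_nonneg (posPart_nonneg _)]
    exact sup_le (add_le_add (le_posPart u) (le_posPart v))
      (add_nonneg (posPart_nonneg u) (posPart_nonneg v))) v
  have hgle : ∀ u, g u ≤ ‖u‖ := fun u => (hg u).trans (hle u)
  refine ⟨g.mkContinuous 1 fun u => ?_, fun u hu => ?_, hgle, ?_⟩
  · rw [one_mul, Real.norm_eq_abs]
    refine abs_le'.2 ⟨hgle u, ?_⟩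
    rw [← map_neg, ← norm_neg u]
    exact hgle (-u)
  · have h := hg (-u)
    have h0 : (-u)⁺ = 0 := posPart_eq_zero.2 (neg_nonpos.2 hu)
    simp only [h0, norm_zero, map_neg] at h
    change 0 ≤ g u
    linarith
  · change g v = ‖v‖
    rw [hgv, posPart_eq_self.2 hv]

variable [CompleteSpace E]

/-- In a Banach lattice with the Schur property, the norm is absolutely continuous on an order
interval with respect to a suitable positive functional, up to a prescribed error. -/
theorem HasSchurProperty.exists_functional (hS : HasSchurProperty E) {x : E} (hx : 0 ≤ x)
    {η : ℝ} (hη : 0 < η) : ∃ φ : E →L[ℝ] ℝ, (∀ u, 0 ≤ u → 0 ≤ φ u) ∧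
      ∃ δ > 0, ∀ v, 0 ≤ v → v ≤ x → φ v < δ → ‖v‖ < η := by
  by_contra! hcon
  let P := {ψ : E →L[ℝ] ℝ // ∀ u, 0 ≤ u → 0 ≤ ψ u}
  have hcon' : ∀ (ψ : P) (n : ℕ), ∃ v, 0 ≤ v ∧ v ≤ x ∧ ψ.1 v < (1 / 2) ^ n ∧ η ≤ ‖v‖ :=
    fun ψ n => hcon ψ.1 ψ.2 _ (by positivity)
  choose V hV0 hVx hVlt hVη using hcon'
  choose Φ hΦ0 hΦle hΦn using exists_positive_norming (E := E)
  -- Each new `v n` is nearly invisible to the norming functionals of all earlier ones, but is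
  -- normed by its own.
  let ψ : ℕ → P := fun n => Nat.rec ⟨0, fun u _ => le_rfl⟩ (fun n ψ =>
    ⟨ψ.1 + Φ (V ψ n) (hV0 ψ n), fun u hu => add_nonneg (ψ.2 u hu) (hΦ0 _ _ u hu)⟩) n
  let v : ℕ → E := fun n => V (ψ n) n
  have hv0 : ∀ n, 0 ≤ v n := fun n => hV0 _ _
  let φ : ℕ → E →L[ℝ] ℝ := fun n => Φ (v n) (hv0 n)
  have hψs : ∀ n, (ψ (n + 1)).1 = (ψ n).1 + φ n := fun n => rfl
  have hφψ : ∀ i j u, i < j → 0 ≤ u → φ i u ≤ (ψ j).1 u := by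
    intro i j u hij hu
    have hmono : Monotone fun j => (ψ j).1 u := monotone_nat_of_le_succ fun n => by
      rw [hψs]
      exact le_add_of_nonneg_right (hΦ0 _ _ u hu)
    refine le_trans ?_ (hmono (Nat.succ_le_of_lt hij))
    simp only [Nat.succ_eq_add_one, hψs]
    exact le_add_of_nonneg_left ((ψ i).2 u hu)
  -- In n and then k, the limits mimic limsup v. Every `φ i` is nonpositive at `W'`, while `φ i (W
  -- i)` is at least η, contradicting W i → W'.
  let w : ℕ → ℕ → E := fun k n => x ⊓ ∑ j ∈ Finset.Ico k n, v j
  have hwx : ∀ k n, w k n ≤ x := fun k n => inf_le_left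
  have hw0 : ∀ k n, 0 ≤ w k n := fun k n => le_inf hx (Finset.sum_nonneg fun j _ => hv0 j)
  have hwmono : ∀ k, Monotone (w k) := fun k m n hmn => inf_le_inf_left x
    (Finset.sum_le_sum_of_subset_of_nonneg (Finset.Ico_subset_Ico_right hmn) fun j _ _ => hv0 j)
  have hwanti : ∀ n, Antitone fun k => w k n := fun n k l hkl => inf_le_inf_left x
    (Finset.sum_le_sum_of_subset_of_nonneg (Finset.Ico_subset_Ico_left hkl) fun j _ _ => hv0 j)
  choose W hW using fun k =>
    cauchySeq_tendsto_of_complete (hS.cauchySeq_of_monotone (hwmono k) (hw0 k) (hwx k))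
  have hWanti : Antitone W := fun k l hkl =>
    le_of_tendsto_of_tendsto' (hW l) (hW k) fun n => hwanti n hkl
  obtain ⟨W', hW'⟩ := cauchySeq_tendsto_of_complete (hS.cauchySeq_of_antitone hWanti (x := x)
    (fun k => ge_of_tendsto' (hW k) (hw0 k)) (fun k => le_of_tendsto' (hW k) (hwx k)))
  have hvW : ∀ k, v k ≤ W k := fun k => by
    refine ge_of_tendsto (hW k) ((eventually_gt_atTop k).mono fun n hn => le_inf (hVx _ _) ?_)
    exact Finset.single_le_sum (f := v) (fun j _ => hv0 j) (Finset.mem_Ico.2 ⟨le_rfl, hn⟩)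
  have hmonoφ : ∀ i {a b : E}, a ≤ b → φ i a ≤ φ i b := fun i a b hab => by
    have h := hΦ0 (v i) (hv0 i) (b - a) (sub_nonneg.2 hab)
    rw [map_sub] at h
    exact sub_nonneg.1 h
  have hφW : ∀ i k, i < k → φ i (W k) ≤ (1 / 2) ^ k * 2 := by
    intro i k hik
    refine le_of_tendsto' (((φ i).continuous.tendsto _).comp (hW k)) fun n => ?_
    calc φ i (w k n) ≤ φ i (∑ j ∈ Finset.Ico k n, v j) := hmonoφ i inf_le_right
      _ = ∑ j ∈ Finset.Ico k n, φ i (v j) := map_sum _ _ _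
      _ ≤ ∑ j ∈ Finset.Ico k n, (1 / 2 : ℝ) ^ j := by
          refine Finset.sum_le_sum fun j hj => ?_
          exact (hφψ i j _ (hik.trans_le (Finset.mem_Ico.1 hj).1) (hv0 j)).trans (hVlt _ _).le
      _ ≤ (1 / 2) ^ k / (1 - 1 / 2) := geom_sum_Ico_le_of_lt_one (by norm_num) (by norm_num)
      _ = (1 / 2) ^ k * 2 := by ring
  have hφW' : ∀ i, φ i W' ≤ 0 := by
    intro i
    have hlim : Tendsto (fun k : ℕ => (1 / 2 : ℝ) ^ k * 2) atTop (𝓝 0) := by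
      simpa using (tendsto_pow_atTop_nhds_zero_of_lt_one (by norm_num : (0 : ℝ) ≤ 1 / 2)
        (by norm_num)).mul_const 2
    exact le_of_tendsto_of_tendsto (((φ i).continuous.tendsto _).comp hW') hlim
      ((eventually_gt_atTop i).mono fun k hk => hφW i k hk)
  have hlim : Tendsto (fun i => ‖W i - W'‖) atTop (𝓝 0) := by
    simpa using (hW'.sub_const W').norm
  obtain ⟨i, hi⟩ := (hlim.eventually_lt_const hη).exists
  refine absurd hi (not_lt.2 ?_)
  calc η ≤ ‖v i‖ := hVη _ _
    _ = φ i (v i) := (hΦn _ _).symm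
    _ ≤ φ i (W i) := hmonoφ i (hvW i)
    _ ≤ φ i (W i) - φ i W' := by linarith [hφW' i]
    _ = φ i (W i - W') := (map_sub _ _ _).symm
    _ ≤ ‖W i - W'‖ := hΦle _ _ _

end

/-! ### Lattice characters and Hilbertian domination. -/

section OrderUnit

variable {V : Type*} [AddCommGroup V] [Lattice V] [IsOrderedAddMonoid V]
  [Module ℝ V] [IsOrderedModule ℝ V]

/-- Sublinear functionals on a vector lattice that preserve finite suprema. -/
structure IsSupSublinear (q : V → ℝ) : Prop where
  add_le : ∀ u v, q (u + v) ≤ q u + q v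
  smul_le : ∀ c : ℝ, 0 < c → ∀ u, q (c • u) ≤ c * q u
  map_sup : ∀ u v, q (u ⊔ v) = max (q u) (q v)

namespace IsSupSublinear

variable {q : V → ℝ}

theorem map_smul (hq : IsSupSublinear q) {c : ℝ} (hc : 0 < c) (u : V) :
    q (c • u) = c * q u := by
  refine le_antisymm (hq.smul_le c hc u) ?_
  have h := hq.smul_le c⁻¹ (inv_pos.2 hc) (c • u)
  rwa [inv_smul_smul₀ hc.ne', le_inv_mul_iff₀ hc] at h

theorem map_zero (hq : IsSupSublinear q) : q 0 = 0 := by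
  have h := hq.map_smul (two_pos : (0 : ℝ) < 2) 0
  rw [smul_zero] at h
  linarith

theorem map_smul_nonneg (hq : IsSupSublinear q) {c : ℝ} (hc : 0 ≤ c) (u : V) :
    q (c • u) = c * q u := by
  rcases hc.eq_or_lt with rfl | h
  · simp [hq.map_zero]
  · exact hq.map_smul h u

theorem neg_le (hq : IsSupSublinear q) (u : V) : -q (-u) ≤ q u := by
  have h := hq.add_le u (-u)
  rw [add_neg_cancel, hq.map_zero] at h
  linarith

/-- Infima of suitably directed families of functionals. -/
theorem iInf {ι : Type*} [Nonempty ι] {F : ι → V → ℝ}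
    (bdd : ∀ u, BddBelow (Set.range fun i => F i u))
    (dir : ∀ i j, ∃ k, (∀ u, F k u ≤ F i u) ∧ ∀ u, F k u ≤ F j u)
    (add : ∀ i j u v, ∃ k, F k (u + v) ≤ F i u + F j v)
    (smul : ∀ (c : ℝ) (_ : 0 < c) i u, ∃ k, F k (c • u) ≤ c * F i u)
    (sup : ∀ i u v, F i (u ⊔ v) = max (F i u) (F i v)) :
    IsSupSublinear fun u => ⨅ i, F i u where
  add_le u v := le_ciInf_add_ciInf fun i j => by
    obtain ⟨k, hk⟩ := add i j u v
    exact (ciInf_le (bdd _) k).trans hk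
  smul_le c hc u := by
    rw [Real.mul_iInf_of_nonneg hc.le]
    refine le_ciInf fun i => ?_
    obtain ⟨k, hk⟩ := smul c hc i u
    exact (ciInf_le (bdd _) k).trans hk
  map_sup u v := by
    refine le_antisymm ?_ (le_ciInf fun i => ?_)
    · by_contra! hlt
      obtain ⟨hu, hv⟩ := max_lt_iff.1 hlt
      obtain ⟨i, hi⟩ := exists_lt_of_ciInf_lt hu
      obtain ⟨j, hj⟩ := exists_lt_of_ciInf_lt hv
      obtain ⟨k, hki, hkj⟩ := dir i j
      have h := ciInf_le (bdd (u ⊔ v)) k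
      rw [sup] at h
      exact absurd h (not_le.2 (max_lt ((hki u).trans_lt hi) ((hkj v).trans_lt hj)))
    · rw [sup]
      exact max_le_max (ciInf_le (bdd u) i) (ciInf_le (bdd v) i)

/-- The largest functional below `q` that is additive in the direction `w`. -/
theorem directional (hq : IsSupSublinear q) (w : V) :
    ∃ r : V → ℝ, IsSupSublinear r ∧ (∀ u, r u ≤ q u) ∧ ∀ u, r u ≤ q (u + w) - q w := by
  -- Decreasing in t by subadditivity; the infimum is the required functional, with t = 0 and t = 1
  -- giving the two bounds.
  let F : {t : ℝ // 0 ≤ t} → V → ℝ := fun t u => q (u + t.1 • w) - t.1 * q w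
  have hbdd : ∀ u, BddBelow (Set.range fun t => F t u) := by
    intro u
    refine ⟨-q (-u), ?_⟩
    rintro _ ⟨⟨t, ht⟩, rfl⟩
    have h := hq.add_le (u + t • w) (-u)
    rw [add_neg_cancel_comm, hq.map_smul_nonneg ht] at h
    change -q (-u) ≤ q (u + t • w) - t * q w
    linarith
  have hanti : ∀ (s t : {t : ℝ // 0 ≤ t}) u,
      F ⟨s.1 + t.1, add_nonneg s.2 t.2⟩ u ≤ F s u := by
    rintro ⟨s, hs⟩ ⟨t, ht⟩ u
    have h := hq.add_le (u + s • w) (t • w)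
    rw [hq.map_smul_nonneg ht, add_assoc, ← add_smul] at h
    change q (u + (s + t) • w) - (s + t) * q w ≤ q (u + s • w) - s * q w
    linarith
  refine ⟨fun u => ⨅ t, F t u, IsSupSublinear.iInf hbdd ?_ ?_ ?_ ?_, fun u => ?_, fun u => ?_⟩
  · intro s t
    refine ⟨⟨s.1 + t.1, add_nonneg s.2 t.2⟩, hanti s t, fun u => ?_⟩
    have h := hanti t s u
    simpa only [add_comm] using h
  · rintro ⟨s, hs⟩ ⟨t, ht⟩ u v
    refine ⟨⟨s + t, add_nonneg hs ht⟩, ?_⟩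
    have h := hq.add_le (u + s • w) (v + t • w)
    rw [add_add_add_comm, ← add_smul] at h
    change q (u + v + (s + t) • w) - (s + t) * q w ≤
      (q (u + s • w) - s * q w) + (q (v + t • w) - t * q w)
    linarith
  · rintro c hc ⟨t, ht⟩ u
    refine ⟨⟨c * t, mul_nonneg hc.le ht⟩, ?_⟩
    have h := hq.smul_le c hc (u + t • w)
    rw [smul_add, smul_smul] at h
    change q (c • u + (c * t) • w) - (c * t) * q w ≤ c * (q (u + t • w) - t * q w)
    linarith
  · rintro ⟨t, ht⟩ u v
    change q (u ⊔ v + t • w) - t * q w = max (q (u + t • w) - t * q w) (q (v + t • w) - t * q w)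
    rw [sup_add, hq.map_sup, max_sub_sub_right]
  · refine (ciInf_le (hbdd u) ⟨0, le_rfl⟩).trans_eq ?_
    simp [F]
  · refine (ciInf_le (hbdd u) ⟨1, zero_le_one⟩).trans_eq ?_
    simp [F]

/-- A sup-preserving sublinear functional dominates a lattice homomorphism. -/
theorem exists_linearMap_le (hq : IsSupSublinear q) : ∃ h : V →ₗ[ℝ] ℝ,
    (∀ u, h u ≤ q u) ∧ ∀ u v, h (u ⊔ v) = max (h u) (h v) := by
  let S : Set (V → ℝ)ᵒᵈ := {r | IsSupSublinear (OrderDual.ofDual r) ∧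
    ∀ u, OrderDual.ofDual r u ≤ q u}
  obtain ⟨m, -, ⟨hm, hmq⟩, hmax⟩ := zorn_le_nonempty₀ S (by
    intro c hcS hc y hy
    have : Nonempty c := ⟨⟨y, hy⟩⟩
    let F : c → V → ℝ := fun r => OrderDual.ofDual r.1
    have hF : ∀ r, IsSupSublinear (F r) := fun r => (hcS r.2).1
    have hbdd : ∀ u, BddBelow (Set.range fun r => F r u) := by
      intro u
      refine ⟨-q (-u), ?_⟩
      rintro _ ⟨r, rfl⟩
      exact le_trans (neg_le_neg ((hcS r.2).2 (-u))) ((hF r).neg_le u)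
    have hdir : ∀ i j, ∃ k, (∀ u, F k u ≤ F i u) ∧ ∀ u, F k u ≤ F j u := by
      intro i j
      rcases hc.total i.2 j.2 with h | h
      · exact ⟨j, fun u => h u, fun u => le_rfl⟩
      · exact ⟨i, fun u => le_rfl, fun u => h u⟩
    refine ⟨OrderDual.toDual fun u => ⨅ r, F r u, ⟨IsSupSublinear.iInf hbdd hdir ?_ ?_ ?_, ?_⟩, ?_⟩
    · intro i j u v
      obtain ⟨k, hki, hkj⟩ := hdir i j
      exact ⟨k, ((hF k).add_le u v).trans (add_le_add (hki u) (hkj v))⟩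
    · exact fun a ha i u => ⟨i, (hF i).smul_le a ha u⟩
    · exact fun i u v => (hF i).map_sup u v
    · exact fun u => (ciInf_le (hbdd u) ⟨y, hy⟩).trans ((hcS hy).2 u)
    · exact fun r hr u => ciInf_le (hbdd u) ⟨r, hr⟩) (OrderDual.toDual q) ⟨hq, fun u => le_rfl⟩
  set p : V → ℝ := OrderDual.ofDual m with hp
  have hadd : ∀ u w, p (u + w) = p u + p w := by
    intro u w
    refine le_antisymm (hm.add_le u w) ?_
    obtain ⟨r, hr, hrp, hrw⟩ := hm.directional w
    -- Minimality: the directional functional at `w` cannot lie strictly below `p`, which forces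
    -- additivity in the direction `w`.
    have h : p u ≤ r u := hmax (y := OrderDual.toDual r)
      ⟨hr, fun u => (hrp u).trans (hmq u)⟩ (fun u => hrp u) u
    have h2 : r u ≤ p (u + w) - p w := hrw u
    linarith
  have hneg : ∀ u, p (-u) = -p u := fun u => by
    have h := hadd u (-u)
    have h0 : p 0 = 0 := hm.map_zero
    rw [add_neg_cancel, h0] at h
    linarith
  refine ⟨{ toFun := p, map_add' := hadd, map_smul' := fun c u => ?_ }, hmq, hm.map_sup⟩
  rcases le_total 0 c with hc | hc
  · exact hm.map_smul_nonneg hc u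
  · have h : p ((-c) • u) = -c * p u := hm.map_smul_nonneg (neg_nonneg.2 hc) u
    rw [neg_smul, hneg] at h
    simp only [RingHom.id_apply, smul_eq_mul]
    linarith

end IsSupSublinear

/-- The gauge `u ↦ inf {t ≥ 0 | u ≤ t e}` of an order unit `e`. -/
noncomputable def orderGauge (e u : V) : ℝ := sInf {t : ℝ | 0 ≤ t ∧ u ≤ t • e}

theorem orderGauge_nonneg (e u : V) : 0 ≤ orderGauge e u :=
  Real.sInf_nonneg fun _ ht => ht.1

theorem orderGauge_le {e u : V} {t : ℝ} (ht : 0 ≤ t) (hu : u ≤ t • e) : orderGauge e u ≤ t :=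
  csInf_le ⟨0, fun _ hs => hs.1⟩ ⟨ht, hu⟩

theorem le_smul_of_orderGauge_lt {e : V} (he0 : 0 ≤ e) (he : ∀ u : V, ∃ t : ℝ, 0 ≤ t ∧ u ≤ t • e)
    {u : V} {t : ℝ} (ht : orderGauge e u < t) : u ≤ t • e := by
  obtain ⟨s, hs, hst⟩ := exists_lt_of_csInf_lt (he u) ht
  exact hs.2.trans (smul_le_smul_of_nonneg_right hst.le he0)

theorem isSupSublinear_orderGauge {e : V} (he0 : 0 ≤ e)
    (he : ∀ u : V, ∃ t : ℝ, 0 ≤ t ∧ u ≤ t • e) : IsSupSublinear (orderGauge e) where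
  add_le u v := by
    refine le_of_forall_pos_le_add fun ε hε => ?_
    have hu := le_smul_of_orderGauge_lt he0 he (lt_add_of_pos_right (orderGauge e u) (half_pos hε))
    have hv := le_smul_of_orderGauge_lt he0 he (lt_add_of_pos_right (orderGauge e v) (half_pos hε))
    have hu0 := orderGauge_nonneg e u
    have hv0 := orderGauge_nonneg e v
    refine (orderGauge_le (t := orderGauge e u + ε / 2 + (orderGauge e v + ε / 2))
      (by positivity) ?_).trans_eq (by ring)
    rw [add_smul]
    exact add_le_add hu hv
  smul_le c hc u := by
    refine le_of_forall_pos_le_add fun ε hε => ?_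
    have hu := le_smul_of_orderGauge_lt he0 he
      (lt_add_of_pos_right (orderGauge e u) (div_pos hε hc))
    have hu0 := orderGauge_nonneg e u
    refine (orderGauge_le (t := c * (orderGauge e u + ε / c)) (by positivity) ?_).trans_eq
      (by field_simp)
    rw [mul_smul]
    exact smul_le_smul_of_nonneg_left hu hc.le
  map_sup u v := by
    have hmono : ∀ {a b : V}, a ≤ b → orderGauge e a ≤ orderGauge e b := fun {a b} hab =>
      le_csInf (he b) fun t ht => orderGauge_le ht.1 (hab.trans ht.2)
    refine le_antisymm ?_ (max_le (hmono le_sup_left) (hmono le_sup_right))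
    refine le_of_forall_gt_imp_ge_of_dense fun t ht => ?_
    obtain ⟨hu, hv⟩ := max_lt_iff.1 ht
    exact orderGauge_le ((orderGauge_nonneg e u).trans hu.le)
      (sup_le (le_smul_of_orderGauge_lt he0 he hu) (le_smul_of_orderGauge_lt he0 he hv))

/-- The normalized real lattice homomorphisms on a vector lattice with order unit `e`. -/
structure LatticeCharacter (e : V) where
  /-- The underlying linear functional. -/
  toLinearMap : V →ₗ[ℝ] ℝ
  map_unit : toLinearMap e = 1
  map_sup : ∀ u v, toLinearMap (u ⊔ v) = max (toLinearMap u) (toLinearMap v)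

namespace LatticeCharacter

variable {e : V}

theorem map_abs (h : LatticeCharacter e) (u : V) : h.1 |u| = |h.1 u| := by
  rw [abs, h.map_sup, map_neg]
  rfl

theorem mono (h : LatticeCharacter e) {u v : V} (huv : u ≤ v) : h.1 u ≤ h.1 v := by
  rw [← sup_eq_right.2 huv, h.map_sup]
  exact le_max_left _ _

theorem abs_le (h : LatticeCharacter e) {u : V} {t : ℝ} (hu : |u| ≤ t • e) : |h.1 u| ≤ t := by
  have h1 := h.mono hu
  rwa [h.map_abs, map_smul, h.map_unit, smul_eq_mul, mul_one] at h1

/-- A homomorphism below the directional gauge at `u` satisfies h(-u) ≤ -q(u) < 0; then u ≤ t e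
gives h(e) > 0, allowing normalization. -/
theorem exists_pos (he0 : 0 ≤ e) (he : ∀ u : V, ∃ t : ℝ, 0 ≤ t ∧ u ≤ t • e) {u : V}
    (hu : 0 < orderGauge e u) : ∃ h : LatticeCharacter e, 0 < h.1 u := by
  have hq := isSupSublinear_orderGauge he0 he
  obtain ⟨r, hr, -, hru⟩ := hq.directional u
  obtain ⟨h, hhr, hsup⟩ := hr.exists_linearMap_le
  have hpos : 0 < h u := by
    have h1 := (hhr (-u)).trans (hru (-u))
    rw [neg_add_cancel, hq.map_zero, map_neg] at h1
    linarith
  have hepos : 0 < h e := by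
    obtain ⟨t, ht, hut⟩ := he u
    have h1 : h u ≤ t * h e := by
      rw [← smul_eq_mul, ← map_smul, ← sup_eq_right.2 hut, hsup]
      exact le_max_left _ _
    by_contra! h0
    have := mul_nonpos_of_nonneg_of_nonpos ht h0
    linarith
  refine ⟨⟨(h e)⁻¹ • h, by simp [hepos.ne'], fun a b => ?_⟩, ?_⟩
  · simp only [LinearMap.smul_apply, smul_eq_mul, hsup]
    exact mul_max_of_nonneg _ _ (inv_nonneg.2 hepos.le)
  · exact mul_pos (inv_pos.2 hepos) hpos

/-- Nonnegativity at all characters gives -u ≤ ε e for every ε > 0, so φ(u) ≥ -ε φ(e); no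
Archimedean property is needed. -/
theorem apply_nonneg (he0 : 0 ≤ e) (he : ∀ u : V, ∃ t : ℝ, 0 ≤ t ∧ u ≤ t • e)
    {φ : V →ₗ[ℝ] ℝ} (hφ : ∀ u, 0 ≤ u → 0 ≤ φ u) {u : V}
    (hu : ∀ h : LatticeCharacter e, 0 ≤ h.1 u) : 0 ≤ φ u := by
  have h0 : orderGauge e (-u) ≤ 0 := by
    by_contra! hpos
    obtain ⟨h, hh⟩ := exists_pos he0 he hpos
    rw [map_neg] at hh
    linarith [hu h]
  have h1 : ∀ ε > 0, 0 ≤ φ u + ε * φ e := by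
    intro ε hε
    have h2 := hφ (ε • e - -u)
      (sub_nonneg.2 (le_smul_of_orderGauge_lt he0 he (h0.trans_lt hε)))
    rw [sub_neg_eq_add, map_add, map_smul, smul_eq_mul] at h2
    linarith
  have hlim : Tendsto (fun ε : ℝ => φ u + ε * φ e) (𝓝[>] 0) (𝓝 (φ u)) := by
    have : Tendsto (fun ε : ℝ => φ u + ε * φ e) (𝓝 0) (𝓝 (φ u + 0 * φ e)) := by
      apply Continuous.tendsto
      fun_prop
    rw [zero_mul, add_zero] at this
    exact this.mono_left nhdsWithin_le_nhds
  exact ge_of_tendsto hlim (eventually_mem_nhdsWithin.mono fun ε hε => h1 ε hε)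

end LatticeCharacter

/-- A positive functional on a vector lattice with order unit `e` is dominated by a Hilbertian
seminorm that is bounded on `[-e, e]`. -/
theorem exists_bilin_of_positive {e : V} (he0 : 0 ≤ e)
    (he : ∀ u : V, ∃ t : ℝ, 0 ≤ t ∧ u ≤ t • e) (φ : V →ₗ[ℝ] ℝ) (hφ : ∀ u, 0 ≤ u → 0 ≤ φ u) :
    ∃ B : V →ₗ[ℝ] V →ₗ[ℝ] ℝ, (∀ u v, B u v = B v u) ∧
      (∀ u (t : ℝ), 2 * t * φ |u| ≤ B u u + t ^ 2 * φ e) ∧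
      ∀ u v, |u| ≤ e → |v| ≤ e → |B u v| ≤ φ e := by
  let : TopologicalSpace (LatticeCharacter e) := ⊥
  have : DiscreteTopology (LatticeCharacter e) := ⟨rfl⟩
  have hbd : ∀ u : V, ∃ C : ℝ, ∀ h : LatticeCharacter e, ‖h.1 u‖ ≤ C := fun u => by
    obtain ⟨t, -, ht⟩ := he |u|
    exact ⟨t, fun h => h.abs_le ht⟩
  choose C hC using hbd
  let ev : V →ₗ[ℝ] BoundedContinuousFunction (LatticeCharacter e) ℝ :=
    { toFun := fun u => BoundedContinuousFunction.ofNormedAddCommGroupDiscrete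
        (fun h => h.1 u) (C u) (hC u)
      map_add' := fun u v => by ext h; exact map_add h.1 u v
      map_smul' := fun c u => by ext h; exact map_smul h.1 c u }
  have hev : ∀ u h, ev u h = h.1 u := fun u h => rfl
  -- M. Riesz extension: the cone couples `u` with bounded functions on the characters, and ‖g‖ e
  -- supplies the cofinality. The extension acts as an integral `Φ` representing `φ`.
  let s : PointedCone ℝ (V × (BoundedContinuousFunction (LatticeCharacter e) ℝ)) :=
    { carrier := {p | ∀ h : LatticeCharacter e, 0 ≤ h.1 p.1 + p.2 h}
      zero_mem' := fun h => by simp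
      add_mem' := fun {a b} ha hb h => by
        have := add_nonneg (ha h) (hb h)
        simp only [Prod.fst_add, Prod.snd_add, map_add, BoundedContinuousFunction.add_apply]
        linarith
      smul_mem' := fun c a ha h => by
        have := mul_nonneg c.2 (ha h)
        change 0 ≤ h.1 (c.1 • a.1) + (c.1 • a.2) h
        simp only [map_smul, BoundedContinuousFunction.coe_smul, smul_eq_mul]
        linarith }
  let f : V × (BoundedContinuousFunction (LatticeCharacter e) ℝ) →ₗ.[ℝ] ℝ :=
    { domain := Submodule.prod ⊤ ⊥
      toFun := (φ.comp (LinearMap.fst ℝ V _)).comp (Submodule.subtype _) }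
  obtain ⟨F, hFf, hFs⟩ := riesz_extension s f (by
    rintro ⟨⟨u, g⟩, hu, hg⟩ hs
    obtain rfl : g = 0 := hg
    refine LatticeCharacter.apply_nonneg he0 he hφ fun h => ?_
    simpa using hs h) (by
    rintro ⟨v, g⟩
    refine ⟨⟨(-v + ‖g‖ • e, 0), trivial, rfl⟩, fun h => ?_⟩
    have h1 := neg_le_of_abs_le (g.norm_coe_le_norm h)
    simp only [Prod.fst_add, Prod.snd_add, zero_add, neg_add_cancel_comm, map_smul, h.map_unit,
      smul_eq_mul, mul_one]
    linarith)
  have hFφ : ∀ u, F (u, 0) = φ u := fun u => hFf ⟨(u, 0), trivial, rfl⟩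
  let Φ : BoundedContinuousFunction (LatticeCharacter e) ℝ →ₗ[ℝ] ℝ := F.comp (LinearMap.inr ℝ V _)
  have hΦ0 : ∀ g : BoundedContinuousFunction (LatticeCharacter e) ℝ, (∀ h, 0 ≤ g h) → 0 ≤ Φ g := fun g hg =>
    hFs (0, g) fun h => by simpa using hg h
  have hΦmono : ∀ g g' : BoundedContinuousFunction (LatticeCharacter e) ℝ, (∀ h, g h ≤ g' h) → Φ g ≤ Φ g' := fun g g' hg => by
    have h1 := hΦ0 (g' - g) fun h => sub_nonneg.2 (hg h)
    rw [map_sub] at h1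
    exact sub_nonneg.1 h1
  have hΦev : ∀ u, Φ (ev u) = φ u := by
    have key : ∀ u, Φ (ev u) ≤ φ u := by
      intro u
      have h1 := hFs (u, -ev u) fun h => by simp [hev]
      have h2 : ((u, -ev u) : V × (BoundedContinuousFunction (LatticeCharacter e) ℝ)) = (u, 0) - (0, ev u) := by simp
      rw [h2, map_sub, hFφ] at h1
      exact sub_nonneg.1 h1
    intro u
    refine le_antisymm (key u) ?_
    have h1 := key (-u)
    rw [map_neg, map_neg, map_neg] at h1
    exact neg_le_neg_iff.1 h1
  refine ⟨LinearMap.mk₂ ℝ (fun u v => Φ (ev u * ev v)) ?_ ?_ ?_ ?_, ?_, ?_, ?_⟩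
  · intro u v w; rw [map_add, add_mul, map_add]
  · intro c u v; rw [map_smul, smul_mul_assoc, map_smul]
  · intro u v w; rw [map_add, mul_add, map_add]
  · intro c u v; rw [map_smul, mul_smul_comm, map_smul]
  · intro u v
    simp only [LinearMap.mk₂_apply, mul_comm]
  · intro u t
    rw [LinearMap.mk₂_apply, ← hΦev, ← hΦev, ← smul_eq_mul, ← smul_eq_mul (t ^ 2), ← map_smul Φ,
      ← map_smul Φ, ← map_add]
    refine hΦmono _ _ fun h => ?_
    simp only [BoundedContinuousFunction.coe_smul, BoundedContinuousFunction.coe_add,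
      BoundedContinuousFunction.coe_mul, Pi.add_apply, Pi.mul_apply, hev, h.map_abs, h.map_unit,
      smul_eq_mul]
    -- Pointwise, 2t|h(u)| ≤ h(u)² + t².
    nlinarith [sq_nonneg (|h.1 u| - t), abs_mul_abs_self (h.1 u)]
  · intro u v hu hv
    have hone : ∀ (h : LatticeCharacter e) {u : V}, |u| ≤ e → |h.1 u| ≤ 1 := fun h u hu =>
      h.abs_le (by rwa [one_smul])
    have hprod : ∀ h : LatticeCharacter e, |h.1 u * h.1 v| ≤ 1 := fun h => by
      rw [abs_mul]
      exact mul_le_one₀ (hone h hu) (abs_nonneg _) (hone h hv)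
    rw [LinearMap.mk₂_apply, ← hΦev]
    refine abs_le'.2 ⟨hΦmono _ _ fun h => ?_, ?_⟩
    · rw [hev, h.map_unit]
      exact (le_abs_self _).trans (hprod h)
    · rw [← map_neg]
      refine hΦmono _ _ fun h => ?_
      rw [hev, h.map_unit]
      exact (neg_le_abs _).trans (hprod h)

end OrderUnit

/-! ### Principal order ideals as vector lattices. -/

section OrderIdeal

variable {V : Type*} [AddCommGroup V] [Lattice V] [IsOrderedAddMonoid V]
  [Module ℝ V] [IsOrderedModule ℝ V]

/-- The order ideal generated by an element. -/
def orderIdeal (x : V) : Submodule ℝ V where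
  carrier := {u | ∃ t : ℝ, 0 ≤ t ∧ |u| ≤ t • |x|}
  zero_mem' := ⟨0, le_rfl, by simp⟩
  add_mem' := by
    rintro u v ⟨s, hs, hu⟩ ⟨t, ht, hv⟩
    refine ⟨s + t, add_nonneg hs ht, (abs_add_le u v).trans ?_⟩
    rw [add_smul]
    exact add_le_add hu hv
  smul_mem' := by
    rintro c u ⟨t, ht, hu⟩
    have h : |c • u| = |c| • |u| := by
      rcases le_total 0 c with hc | hc
      · rw [abs_of_nonneg hc, abs_smul_of_nonneg hc]
      · rw [abs_of_nonpos hc, ← abs_neg, ← neg_smul, abs_smul_of_nonneg (neg_nonneg.2 hc)]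
    refine ⟨|c| * t, mul_nonneg (abs_nonneg c) ht, ?_⟩
    rw [h, mul_smul]
    exact smul_le_smul_of_nonneg_left hu (abs_nonneg c)

theorem abs_sup_le_abs_add_abs (u v : V) : |u ⊔ v| ≤ |u| + |v| := by
  refine abs_le'.2 ⟨sup_le ?_ ?_, ?_⟩
  · exact (le_abs_self u).trans (le_add_of_nonneg_right (abs_nonneg v))
  · exact (le_abs_self v).trans (le_add_of_nonneg_left (abs_nonneg u))
  · exact (neg_le_neg le_sup_left).trans
      ((neg_le_abs u).trans (le_add_of_nonneg_right (abs_nonneg v)))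

theorem mem_orderIdeal_of_abs_le {x u v : V} (hv : v ∈ orderIdeal x) (h : |u| ≤ |v|) :
    u ∈ orderIdeal x := by
  obtain ⟨t, ht, htv⟩ := hv
  exact ⟨t, ht, h.trans htv⟩

theorem sup_mem_orderIdeal {x : V} ⦃u v : V⦄ (hu : u ∈ orderIdeal x) (hv : v ∈ orderIdeal x) :
    u ⊔ v ∈ orderIdeal x := by
  have habs : ∀ {w : V}, w ∈ orderIdeal x → |w| ∈ orderIdeal x := fun hw =>
    mem_orderIdeal_of_abs_le hw (abs_abs _).le
  refine mem_orderIdeal_of_abs_le ((orderIdeal x).add_mem (habs hu) (habs hv)) ?_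
  exact (abs_sup_le_abs_add_abs u v).trans (le_abs_self _)

theorem inf_mem_orderIdeal {x : V} ⦃u v : V⦄ (hu : u ∈ orderIdeal x) (hv : v ∈ orderIdeal x) :
    u ⊓ v ∈ orderIdeal x := by
  have h := (orderIdeal x).neg_mem
    (sup_mem_orderIdeal ((orderIdeal x).neg_mem hu) ((orderIdeal x).neg_mem hv))
  rwa [neg_sup, neg_neg, neg_neg] at h

instance orderIdeal.instLattice (x : V) : Lattice (orderIdeal x) :=
  Subtype.lattice sup_mem_orderIdeal inf_mem_orderIdeal

instance orderIdeal.instIsOrderedAddMonoid (x : V) : IsOrderedAddMonoid (orderIdeal x) where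
  add_le_add_left _ _ h c := add_le_add_left (α := V) h c.1

instance orderIdeal.instIsOrderedModule (x : V) : IsOrderedModule ℝ (orderIdeal x) where
  smul_le_smul_of_nonneg_left _ hc _ _ h :=
    smul_le_smul_of_nonneg_left (β := V) h hc
  smul_le_smul_of_nonneg_right u hu _ _ h :=
    smul_le_smul_of_nonneg_right (β := V) h (show (0 : V) ≤ u.1 from hu)

end OrderIdeal

/-! ### Sums of asymptotically orthogonal vectors. -/

section Hilbert

variable {V : Type*} [AddCommGroup V] [Lattice V] [IsOrderedAddMonoid V]
  [Module ℝ V] [IsOrderedModule ℝ V]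

/-- Sums of `k` suitably chosen members of a sequence converging weakly to `0` for a positive
bilinear form have size `O(√k)`. -/
theorem exists_sum_bilin_le {B : V →ₗ[ℝ] V →ₗ[ℝ] ℝ} (hB : ∀ u v, B u v = B v u) {e : V} {M : ℝ}
    {d : ℕ → V} (hde : ∀ n, |d n| ≤ e) (hdM : ∀ n, B (d n) (d n) ≤ M)
    (hd : ∀ m, Tendsto (fun n => B (d m) (d n)) atTop (𝓝 0)) {f : V →ₗ[ℝ] ℝ} {δ : ℝ}
    (hf : ∃ᶠ n in atTop, δ ≤ f (d n)) (k : ℕ) :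
    ∃ s : V, |s| ≤ (k : ℝ) • e ∧ k * δ ≤ f s ∧ B s s ≤ k * (M + 1) ∧
      Tendsto (fun n => B s (d n)) atTop (𝓝 0) := by
  induction k with
  | zero => exact ⟨0, by simp⟩
  | succ k ih =>
    obtain ⟨s, hse, hsf, hsB, hs⟩ := ih
    -- Keeping `B s (d n)` below 1/2 makes the two cross terms cost at most the 1 in `M + 1`.
    obtain ⟨n, hn, hn'⟩ := (hf.and_eventually
      (hs.eventually_lt_const (by norm_num : (0 : ℝ) < 1 / 2))).exists
    refine ⟨s + d n, ?_, ?_, ?_, ?_⟩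
    · refine (abs_add_le _ _).trans ?_
      push_cast
      rw [add_smul, one_smul]
      exact add_le_add hse (hde n)
    · rw [map_add]
      push_cast
      linarith
    · have h := hdM n
      simp only [map_add, LinearMap.add_apply, hB (d n) s]
      push_cast
      linarith
    · simpa using hs.add (hd n)

end Hilbert

/-! ### Compactness from the Schur property. -/

section

variable {E : Type*} [NormedAddCommGroup E] [NormedSpace ℝ E] [Lattice E]
  [IsOrderedAddMonoid E] [IsOrderedModule ℝ E] [HasSolidNorm E] [CompleteSpace E]

/-- In a Banach lattice with the Schur property, every sequence in an order interval has a
subsequence whose successive differences are weakly null. -/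
theorem HasSchurProperty.exists_subseq_isWeaklyNull (hS : HasSchurProperty E) {x : E}
    (hx : 0 ≤ x) {a : ℕ → E} (ha : ∀ n, a n ∈ Set.Icc 0 x) :
    ∃ σ : ℕ → ℕ, StrictMono σ ∧ IsWeaklyNull fun n => a (σ (2 * n)) - a (σ (2 * n + 1)) := by
  choose φ hφ0 δ hδ hφ using fun j : ℕ =>
    hS.exists_functional hx (η := 1 / ((j : ℝ) + 1)) (by positivity)
  let V := orderIdeal x
  let e : V := ⟨x, 1, zero_le_one, by simp⟩
  have he0 : 0 ≤ e := hx
  have he : ∀ u : V, ∃ t : ℝ, 0 ≤ t ∧ u ≤ t • e := by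
    rintro ⟨u, t, ht, hu⟩
    refine ⟨t, ht, ?_⟩
    rw [abs_of_nonneg hx] at hu
    exact (le_abs_self u).trans hu
  choose B hBsymm hBφ hBe using fun j =>
    exists_bilin_of_positive he0 he ((φ j : E →ₗ[ℝ] ℝ).comp V.subtype) fun u hu => hφ0 j u hu
  let b : ℕ → V := fun n => ⟨a n, 1, zero_le_one, by
    rw [abs_of_nonneg (ha n).1, abs_of_nonneg hx, one_smul]
    exact (ha n).2⟩
  have hbe : ∀ n, |b n| ≤ e := fun n => by
    change |a n| ≤ x
    rw [abs_of_nonneg (ha n).1]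
    exact (ha n).2
  -- Compactness of the product does the diagonal extraction for all pairs (form, term) at once.
  have hcomp : IsCompact (Set.pi Set.univ fun p : ℕ × ℕ =>
      Set.Icc (-φ p.1 x) (φ p.1 x)) := isCompact_univ_pi fun _ => isCompact_Icc
  obtain ⟨L, -, σ, hσ, hL⟩ := hcomp.tendsto_subseq
    (x := fun n (p : ℕ × ℕ) => B p.1 (b p.2) (b n))
    fun n p _ => abs_le.1 (hBe p.1 _ _ (hbe _) (hbe _))
  have hL' : ∀ j m, Tendsto (fun n => B j (b m) (b (σ n))) atTop (𝓝 (L (j, m))) := fun j m =>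
    (tendsto_pi_nhds.1 hL) (j, m)
  refine ⟨σ, hσ, ?_⟩
  let d : ℕ → V := fun n => b (σ (2 * n)) - b (σ (2 * n + 1))
  have hde : ∀ n, |d n| ≤ e := fun n => by
    change |a (σ (2 * n)) - a (σ (2 * n + 1))| ≤ x
    refine abs_le'.2 ⟨?_, ?_⟩
    · exact (sub_le_self _ (ha _).1).trans (ha _).2
    · rw [neg_sub]
      exact (sub_le_self _ (ha _).1).trans (ha _).2
  have h2 : Tendsto (fun n : ℕ => 2 * n) atTop atTop :=
    tendsto_id.const_mul_atTop' (by norm_num)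
  have hbd : ∀ j m, Tendsto (fun n => B j (b m) (d n)) atTop (𝓝 0) := fun j m => by
    have h := ((hL' j m).comp h2).sub
      ((hL' j m).comp ((tendsto_add_atTop_nat 1).comp h2))
    rw [sub_self] at h
    exact h.congr fun n => (map_sub (B j (b m)) _ _).symm
  have hdd : ∀ j m, Tendsto (fun n => B j (d m) (d n)) atTop (𝓝 0) := fun j m => by
    have h := (hbd j (σ (2 * m))).sub (hbd j (σ (2 * m + 1)))
    rw [sub_self] at h
    refine h.congr fun n => ?_
    rw [← LinearMap.sub_apply, ← map_sub]
  have key : ∀ (f : E →L[ℝ] ℝ) (ε : ℝ), 0 < ε → ∀ᶠ n in atTop, f (d n) < ε := by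
    intro f ε hε
    by_contra hcon
    have hfreq : ∃ᶠ n in atTop, ε ≤ ((f : E →ₗ[ℝ] ℝ).comp V.subtype) (d n) :=
      (not_eventually.1 hcon).mono fun n hn => not_lt.1 hn
    obtain ⟨j, hj⟩ := exists_nat_gt (‖f‖ / ε)
    have hM : 0 ≤ φ j x := hφ0 j x hx
    -- With φ(x) + 1 = tδ and k chosen so that tφ(x) < kδ, the Hilbertian bound yields 2tk φ(v) <
    -- 2tk δ for the average modulus `v`.
    set t : ℝ := (φ j x + 1) / δ j with ht
    have htpos : 0 < t := div_pos (by linarith) (hδ j)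
    obtain ⟨k, hk⟩ := exists_nat_gt (t * φ j x / δ j)
    have hkpos : (0 : ℝ) < k := lt_of_le_of_lt
      (div_nonneg (mul_nonneg htpos.le hM) (hδ j).le) hk
    obtain ⟨s, hse, hsf, hsB, -⟩ := exists_sum_bilin_le (hBsymm j) hde
      (fun n => (le_abs_self _).trans (hBe j _ _ (hde n) (hde n))) (hdd j) hfreq k
    have hse' : |(s : E)| ≤ (k : ℝ) • x := hse
    have hsφ : 2 * t * φ j |(s : E)| ≤ k * (φ j x + 1) + t ^ 2 * φ j x :=
      (hBφ j s t).trans (add_le_add_left hsB _)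
    set v : E := (k : ℝ)⁻¹ • |(s : E)| with hv
    have hkv : (k : ℝ) • v = |(s : E)| := smul_inv_smul₀ hkpos.ne' _
    have hv0 : 0 ≤ v := smul_nonneg (inv_nonneg.2 hkpos.le) (abs_nonneg _)
    have hvx : v ≤ x := by
      have h := smul_le_smul_of_nonneg_left hse' (inv_nonneg.2 hkpos.le)
      rwa [inv_smul_smul₀ hkpos.ne'] at h
    have hφv : φ j v < δ j := by
      rw [← hkv, map_smul, smul_eq_mul] at hsφ
      have h1 : t * φ j x < k * δ j := by rwa [div_lt_iff₀ (hδ j)] at hk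
      have h2 : φ j x + 1 = t * δ j := by rw [ht, div_mul_cancel₀ _ (hδ j).ne']
      rw [h2] at hsφ
      have h3 : t * (t * φ j x) < t * (k * δ j) := mul_lt_mul_of_pos_left h1 htpos
      have h4 : (2 * t * k) * φ j v < (2 * t * k) * δ j := by nlinarith
      exact lt_of_mul_lt_mul_left h4 (by positivity)
    have hvn := hφ j v hv0 hvx hφv
    have hsn : ‖(s : E)‖ = k * ‖v‖ := by
      rw [← norm_abs_eq_norm, ← hkv, norm_smul, Real.norm_of_nonneg hkpos.le]
    have h1 : k * ε ≤ k * (‖f‖ * ‖v‖) := by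
      refine hsf.trans ((le_abs_self _).trans ((f.le_opNorm _).trans_eq ?_))
      change ‖f‖ * ‖(s : E)‖ = _
      rw [hsn]
      ring
    have h2 : ε ≤ ‖f‖ * ‖v‖ := le_of_mul_le_mul_left h1 hkpos
    have h3 : ‖f‖ * ‖v‖ ≤ ‖f‖ * (1 / ((j : ℝ) + 1)) :=
      mul_le_mul_of_nonneg_left hvn.le (norm_nonneg f)
    rw [div_lt_iff₀ hε] at hj
    rw [mul_one_div] at h3
    have h4 := h2.trans h3
    rw [le_div_iff₀ (by positivity)] at h4
    linarith
  refine isWeaklyNull_iff.2 fun f => ?_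
  rw [Metric.tendsto_nhds]
  intro ε hε
  filter_upwards [key f ε hε, key (-f) ε hε] with n hn hn'
  rw [dist_zero_right, Real.norm_eq_abs, abs_lt]
  rw [neg_apply] at hn'
  exact ⟨neg_lt.1 hn', hn⟩

theorem HasSchurProperty.totallyBounded_Icc (hS : HasSchurProperty E) {x : E} (hx : 0 ≤ x) :
    TotallyBounded (Set.Icc 0 x) := by
  rw [Metric.totallyBounded_iff]
  by_contra! hcon
  obtain ⟨ε, hε, hcon⟩ := hcon
  obtain ⟨a, ha, hsep⟩ := exists_seq_of_forall_finset_exists (fun u : E => u ∈ Set.Icc 0 x)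
    (fun u v => ε ≤ dist u v) fun s _ => by
      obtain ⟨y, hy, hys⟩ := Set.not_subset.1 (hcon s s.finite_toSet)
      refine ⟨y, hy, fun z hz => ?_⟩
      by_contra! hlt
      exact hys (Set.mem_biUnion hz (by rwa [Metric.mem_ball, dist_comm]))
  obtain ⟨σ, hσ, hnull⟩ := hS.exists_subseq_isWeaklyNull hx ha
  obtain ⟨n, hn⟩ := ((hS _ hnull).eventually_lt_const hε).exists
  refine absurd hn (not_lt.2 ?_)
  rw [← dist_eq_norm]
  exact hsep _ _ (hσ (Nat.lt_succ_self _))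

/-- Truncation moves `A` by less than ε/2 into [-y, y], a translate of the totally bounded interval
[0, 2y]. -/
theorem HasSchurProperty.isRelativelyCompact (hS : HasSchurProperty E) {A : Set E}
    (hA : IsDisjointlyWeaklyCompact A) : IsRelativelyCompact A := by
  refine TotallyBounded.isCompact_of_isClosed (TotallyBounded.closure ?_) isClosed_closure
  rw [Metric.totallyBounded_iff]
  intro ε hε
  obtain ⟨y, hy, hAy⟩ := hA.exists_norm_posPart_lt hS (half_pos hε)
  obtain ⟨t, ht, hcov⟩ := Metric.totallyBounded_iff.1
    (hS.totallyBounded_Icc (add_nonneg hy hy)) (ε / 2) (half_pos hε)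
  refine ⟨(fun z => z - y) '' t, ht.image _, fun u hu => ?_⟩
  have htr := abs_le'.1 (abs_truncate_le (u := u) hy)
  have hmem : truncate u y + y ∈ Set.Icc 0 (y + y) :=
    ⟨neg_le_iff_add_nonneg.1 (neg_le.1 htr.2), add_le_add_left htr.1 y⟩
  obtain ⟨z, hz, hdist⟩ := Set.mem_iUnion₂.1 (hcov hmem)
  refine Set.mem_biUnion ⟨z, hz, rfl⟩ ?_
  have h1 : ‖u - truncate u y‖ < ε / 2 :=
    (norm_le_norm_of_abs_le (abs_sub_truncate_le u y)).trans_lt (hAy u hu)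
  have h2 : ‖truncate u y + y - z‖ < ε / 2 := by rwa [← dist_eq_norm]
  rw [Metric.mem_ball, dist_eq_norm]
  calc ‖u - (z - y)‖ = ‖(u - truncate u y) + (truncate u y + y - z)‖ := by congr 1; abel
    _ ≤ ‖u - truncate u y‖ + ‖truncate u y + y - z‖ := norm_add_le _ _
    _ < ε := by linarith

end

end DWCompactness

/-! ### The equivalence. -/

theorem mainTheorem7 (E : Type u) [NormedAddCommGroup E] [NormedSpace ℝ E]
    [CompleteSpace E] [Lattice E] [IsOrderedAddMonoid E] [IsOrderedModule ℝ E] [HasSolidNorm E] :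
    List.TFAE [
      DWCompactness.HasSchurProperty E,
      ∀ A : Set E, DWCompactness.IsDisjointlyWeaklyCompact A →
        DWCompactness.IsRelativelyCompact A,
      DWCompactness.IsDWCompact (ContinuousLinearMap.id ℝ E),
      ∀ (X : Type v) [NormedAddCommGroup X] [NormedSpace ℝ X] [CompleteSpace X] (T : E →L[ℝ] X),
        DWCompactness.IsDWCompact T,
      ∀ T : E →L[ℝ] lp (fun _ : ℕ => ℝ) ∞, DWCompactness.IsDWCompact T] := by
  tfae_have 1 → 2 := fun hS A hA => hS.isRelativelyCompact hA
  tfae_have 2 → 3 := fun h A hA => by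
    simpa using h A hA
  tfae_have 3 → 4 := fun h X _ _ _ T => by
    simpa using h.of_comp (ContinuousLinearMap.id ℝ E) T
  tfae_have 4 → 5 := fun h T => by
    -- The target spaces range over universe `v`, so ℓ∞ is lifted there and brought back by
    -- composition.
    let up : lp (fun _ : ℕ => ℝ) ∞ ≃L[ℝ] ULift.{v} (lp (fun _ : ℕ => ℝ) ∞) :=
      ContinuousLinearEquiv.ulift.symm
    have h1 := (h _ ((up : lp (fun _ : ℕ => ℝ) ∞ →L[ℝ] _).comp T)).of_comp _
      up.symm.toContinuousLinearMap
    convert! h1 using 1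
  tfae_have 5 → 1 := DWCompactness.hasSchurProperty_of_isDWCompact_lp
  tfae_finish
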